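/- Let $d\ge 1$ and let $\nu$ be a Lévy measure on $\mathbb R^d\setminus\{0\}$, i.e. $\int_{z\ne0}(1\wedge|z|^2)\,\nu(dz)<\infty$. Let $(X_t)_{t\ge0}$ be a pure jump Lévy process on $\mathbb R^d$, started at $0$, with Lévy measure $\nu$, i.e. $\mathbb E\,e^{i\langle\xi,X_t\rangle}=e^{-t\Phi(\xi)}$ for all $t\ge 0$, $\xi\in\mathbb R^d$, with symbol $$\Phi(\xi)=\int_{z\neq0}\Big(1-e^{i\langle\xi,z\rangle}+i\langle\xi,z\rangle\mathbf 1_{B(0,1)}(z)\Big)\,\nu(dz).$$ For bounded Borel functions $u:\mathbb R^d\to\mathbb R$ (that is, $u\in B_b(\mathbb R^d)$) let $P_tu(x)=\mathbb E\,u(x+X_t)$, $\|u\|_\infty=\sup_x|u(x)|$, and $$|\nabla u(x)|=\limsup_{y\to x}\frac{|u(y)-u(x)|}{|y-x|},\qquad \|\nabla u\|_\infty=\sup_{x\in\mathbb R^d}|\nabla u(x)|.$$ Assume that $$\liminf_{|\xi|\to\infty}\frac{\operatorname{Re}\Phi(\xi)}{\log(1+|\xi|)}=\infty .$$ For $\rho>0$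 let $\varphi(\rho)=\sup_{|\eta|\le\rho}\operatorname{Re}\Phi(\eta)$, and let $\varphi^{-1}:(0,\infty)\to(0,\infty)$ be an inverse of $\varphi$, i.e. any function such that $\varphi(\varphi^{-1}(s))=s$ for all $s>0$. (a) Small times. If there are constants $c_0,t_0>0$ such that $$\int_{\mathbb R^d}e^{-t\operatorname{Re}\Phi(\xi)}|\xi|^{d+2}\,d\xi\le c_0\,\big(\varphi^{-1}(1/t)\big)^{2d+2}\tag{$*$}$$ for all $0<t\le t_0$, then there are constants $c,t_1>0$ such that for all $u\in B_b(\mathbb R^d)$ $$\|\nabla P_tu\|_\infty\le c\,\|u\|_\infty\,\varphi^{-1}(1/t)\tag{$**$}$$ for all $0<t\le t_1$. (b) Large times. If there are constants $c_0,t_0>0$ such that $(*)$ holds for all $t\ge t_0$, then there are constants $c,t_1>0$ such that $(**)$ holds for all $u\in B_b(\mathbb R^d)$ and all $t\ge t_1$. -/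

import Mathlib

open MeasureTheory ProbabilityTheory Filter Topology
open scoped NNReal ENNReal

namespace LevyGradient

variable {d : ℕ}

/-- `ν` is a Lévy measure: a measure on `ℝ^d \ {0}` (viewed as a measure on `ℝ^d` which does not
charge the origin) with `∫ (1 ∧ |z|²) ν(dz) < ∞`. Such a measure is automatically σ-finite. -/
structure IsLevyMeasure (ν : Measure (EuclideanSpace ℝ (Fin d))) : Prop where
  zero_singleton : ν {0} = 0
  lintegral_lt_top : ∫⁻ z, ENNReal.ofReal (min 1 (‖z‖ ^ 2)) ∂ν < ∞

/-- The integrand `1 - e^{i⟨ξ,z⟩} + i⟨ξ,z⟩ 𝟙_{B(0,1)}(z)`. -/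
noncomputable def symbolIntegrand (ξ z : EuclideanSpace ℝ (Fin d)) : ℂ :=
  1 - Complex.exp (Complex.I * ((inner ℝ ξ z : ℝ) : ℂ))
    + Complex.I * ((inner ℝ ξ z : ℝ) : ℂ)
      * (Metric.ball (0 : EuclideanSpace ℝ (Fin d)) 1).indicator (fun _ => (1 : ℂ)) z

/-- The symbol (characteristic exponent) `Φ(ξ)` of the pure jump Lévy process with Lévy
measure `ν`. -/
noncomputable def symbol (ν : Measure (EuclideanSpace ℝ (Fin d)))
    (ξ : EuclideanSpace ℝ (Fin d)) : ℂ :=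
  ∫ z in {0}ᶜ, symbolIntegrand ξ z ∂ν

/-- A Lévy process `(X_t)_{t ≥ 0}` on `ℝ^d` started at the origin: independent and stationary
increments and stochastic continuity. -/
structure IsLevyProcess {Ω : Type*} [MeasurableSpace Ω] (P : Measure Ω)
    (X : ℝ≥0 → Ω → EuclideanSpace ℝ (Fin d)) : Prop where
  measurable : ∀ t, Measurable (X t)
  start_zero : ∀ᵐ ω ∂P, X 0 ω = 0
  indep_increments : HasIndepIncrements X P
  stationary_increments : ∀ s t : ℝ≥0,
    IdentDistrib (fun ω => X (s + t) ω - X s ω) (X t) P P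
  stochastically_continuous : ∀ s : ℝ≥0, TendstoInMeasure P X (𝓝 s) (X s)

/-- A pure jump Lévy process with Lévy measure `ν`: a Lévy process with
`E e^{i⟨ξ,X_t⟩} = e^{-tΦ(ξ)}`, where `Φ` is the symbol of `ν`. -/
structure IsPureJumpLevyProcess {Ω : Type*} [MeasurableSpace Ω] (P : Measure Ω)
    (X : ℝ≥0 → Ω → EuclideanSpace ℝ (Fin d)) (ν : Measure (EuclideanSpace ℝ (Fin d))) : Prop
    extends IsLevyProcess P X where
  levyMeasure : IsLevyMeasure ν
  charFun_eq : ∀ (t : ℝ≥0) (ξ : EuclideanSpace ℝ (Fin d)),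
    charFun (P.map (X t)) ξ = Complex.exp (-((t : ℝ) : ℂ) * symbol ν ξ)

/-- The transition semigroup `P_t u(x) = E u(x + X_t)`. -/
noncomputable def semigroup {Ω : Type*} [MeasurableSpace Ω] (P : Measure Ω)
    (X : ℝ≥0 → Ω → EuclideanSpace ℝ (Fin d)) (t : ℝ≥0)
    (u : EuclideanSpace ℝ (Fin d) → ℝ) (x : EuclideanSpace ℝ (Fin d)) : ℝ :=
  ∫ ω, u (x + X t ω) ∂P

/-- The Hartman-Wintner condition
`liminf_{|ξ| → ∞} Re Φ(ξ) / log (1 + |ξ|) = ∞`. -/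
def HartmanWintner (Φ : EuclideanSpace ℝ (Fin d) → ℂ) : Prop :=
  liminf (fun ξ => (((Φ ξ).re / Real.log (1 + ‖ξ‖) : ℝ) : EReal))
    (Bornology.cobounded (EuclideanSpace ℝ (Fin d))) = ⊤

/-- `φ(ρ) = sup_{|η| ≤ ρ} Re Φ(η)`. -/
noncomputable def supRe (Φ : EuclideanSpace ℝ (Fin d) → ℂ) (ρ : ℝ) : ℝ :=
  sSup ((fun η => (Φ η).re) '' Metric.closedBall 0 ρ)

/-- `ψ` is an inverse `φ⁻¹ : (0,∞) → (0,∞)` of the nondecreasing function `φ`, i.e.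
`φ(φ⁻¹(s)) = s` for all `s > 0`. (It is unique if `φ` is strictly increasing; if `φ` has flat
pieces, every choice of the inverse is admitted.) -/
def IsInverse (φ ψ : ℝ → ℝ) : Prop :=
  ∀ s, 0 < s → 0 < ψ s ∧ φ (ψ s) = s

/-- `|∇u(x)| = limsup_{y → x} |u(y) - u(x)| / |y - x| ∈ [0,∞]`. -/
noncomputable def gradAbs (u : EuclideanSpace ℝ (Fin d) → ℝ)
    (x : EuclideanSpace ℝ (Fin d)) : ℝ≥0∞ :=
  limsup (fun y => ENNReal.ofReal (|u y - u x| / ‖y - x‖)) (𝓝[≠] x)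

/-- `‖∇u‖_∞ = sup_x |∇u(x)| ∈ [0,∞]`. -/
noncomputable def gradSup (u : EuclideanSpace ℝ (Fin d) → ℝ) : ℝ≥0∞ := ⨆ x, gradAbs u x

/-- `‖u‖_∞ = sup_x |u(x)| ∈ [0,∞]`. -/
noncomputable def supNorm (u : EuclideanSpace ℝ (Fin d) → ℝ) : ℝ≥0∞ :=
  ⨆ x, ENNReal.ofReal |u x|

/-- `u ∈ B_b(ℝ^d)`: `u` is bounded and Borel measurable. -/
def IsBoundedBorel (u : EuclideanSpace ℝ (Fin d) → ℝ) : Prop :=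
  Measurable u ∧ ∃ C : ℝ, ∀ x, |u x| ≤ C

/-- `∫ e^{-t Re Φ(ξ)} |ξ|^{d+2} dξ ∈ [0,∞]`. -/
noncomputable def momentIntegral (Φ : EuclideanSpace ℝ (Fin d) → ℂ) (t : ℝ) : ℝ≥0∞ :=
  ∫⁻ ξ, ENNReal.ofReal (Real.exp (-(t * (Φ ξ).re)) * ‖ξ‖ ^ (d + 2))

/-! The inverse of `φ` exists. -/

lemma norm_symbolIntegrand_le (ξ z : EuclideanSpace ℝ (Fin d)) :
    ‖symbolIntegrand ξ z‖ ≤ (3 * ‖ξ‖ ^ 2 + 2) * min 1 (‖z‖ ^ 2) := by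
  have hin : |inner ℝ ξ z| ≤ ‖ξ‖ * ‖z‖ := abs_real_inner_le_norm ξ z
  have hsq : (inner ℝ ξ z) ^ 2 ≤ ‖ξ‖ ^ 2 * ‖z‖ ^ 2 := by
    rw [← sq_abs, ← mul_pow]; gcongr
  have hexp : ‖Complex.exp (Complex.I * ((inner ℝ ξ z : ℝ) : ℂ))‖ = 1 := by
    rw [mul_comm]; exact Complex.norm_exp_ofReal_mul_I _
  unfold symbolIntegrand
  set a : ℝ := inner ℝ ξ z
  by_cases hz : z ∈ Metric.ball (0 : EuclideanSpace ℝ (Fin d)) 1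
  · have hz1 : ‖z‖ < 1 := by simpa using hz
    have hmin : min 1 (‖z‖ ^ 2) = ‖z‖ ^ 2 := min_eq_right (by nlinarith [norm_nonneg z])
    rw [hmin, Set.indicator_of_mem hz, mul_one]
    have hIa : ‖Complex.I * (a : ℂ)‖ = |a| := by simp
    have key : ‖1 - Complex.exp (Complex.I * (a : ℂ)) + Complex.I * (a : ℂ)‖ ≤ 3 * a ^ 2 := by
      rcases le_or_gt |a| 1 with h | h
      · have h2 := Complex.norm_exp_sub_one_sub_id_le (x := Complex.I * (a : ℂ)) (by rwa [hIa])
        have e : 1 - Complex.exp (Complex.I * (a : ℂ)) + Complex.I * (a : ℂ)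
            = -(Complex.exp (Complex.I * (a : ℂ)) - 1 - Complex.I * (a : ℂ)) := by ring
        rw [e, norm_neg]
        rw [hIa, sq_abs] at h2
        nlinarith [sq_nonneg a]
      · have h2 := norm_add_le (1 - Complex.exp (Complex.I * (a : ℂ))) (Complex.I * (a : ℂ))
        have h3 := norm_sub_le (1 : ℂ) (Complex.exp (Complex.I * (a : ℂ)))
        rw [hexp, norm_one] at h3
        rw [hIa] at h2
        have h4 : a ^ 2 = |a| ^ 2 := (sq_abs a).symm
        nlinarith
    nlinarith [sq_nonneg ‖z‖]
  · have hz1 : 1 ≤ ‖z‖ := by simpa using hz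
    have hmin : min 1 (‖z‖ ^ 2) = 1 := min_eq_left (by nlinarith)
    rw [hmin, Set.indicator_of_notMem hz, mul_zero, add_zero, mul_one]
    have h3 := norm_sub_le (1 : ℂ) (Complex.exp (Complex.I * (a : ℂ)))
    rw [hexp, norm_one] at h3
    nlinarith [sq_nonneg ‖ξ‖]

lemma measurable_symbolIntegrand (ξ : EuclideanSpace ℝ (Fin d)) :
    Measurable (symbolIntegrand ξ) := by
  unfold symbolIntegrand
  have : Measurable ((Metric.ball (0 : EuclideanSpace ℝ (Fin d)) 1).indicator
      (fun _ => (1 : ℂ))) := measurable_const.indicator Metric.isOpen_ball.measurableSet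
  fun_prop

lemma continuous_symbol {ν : Measure (EuclideanSpace ℝ (Fin d))} (hν : IsLevyMeasure ν) :
    Continuous (symbol ν) := by
  rw [continuous_iff_continuousAt]
  intro ξ₀
  have hint : Integrable (fun z : EuclideanSpace ℝ (Fin d) => min 1 (‖z‖ ^ 2)) ν := by
    refine ⟨by fun_prop, ?_⟩
    rw [hasFiniteIntegral_iff_ofReal (Eventually.of_forall fun z => by positivity)]
    exact hν.lintegral_lt_top
  unfold symbol
  refine continuousAt_of_dominated
    (bound := fun z => (3 * (‖ξ₀‖ + 1) ^ 2 + 2) * min 1 (‖z‖ ^ 2)) ?_ ?_ ?_ ?_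
  · exact Eventually.of_forall fun ξ => (measurable_symbolIntegrand ξ).aestronglyMeasurable
  · filter_upwards [Metric.ball_mem_nhds ξ₀ one_pos] with ξ hξ
    refine Eventually.of_forall fun z => (norm_symbolIntegrand_le ξ z).trans ?_
    have h1 : ‖ξ‖ ≤ ‖ξ₀‖ + 1 := by
      have := norm_sub_norm_le ξ ξ₀
      rw [mem_ball_iff_norm] at hξ
      linarith
    gcongr
  · exact (hint.const_mul _).integrableOn
  · refine Eventually.of_forall fun z => Continuous.continuousAt ?_
    unfold symbolIntegrand
    fun_prop

lemma exists_isInverse (hd : 1 ≤ d) {ν : Measure (EuclideanSpace ℝ (Fin d))}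
    (hν : IsLevyMeasure ν) (hHW : HartmanWintner (symbol ν)) :
    ∃ ψ, IsInverse (supRe (symbol ν)) ψ := by
  have : Nonempty (Fin d) := ⟨⟨0, hd⟩⟩
  set f : EuclideanSpace ℝ (Fin d) → ℝ := fun η => (symbol ν η).re with hf
  have hfc : Continuous f := Complex.continuous_re.comp (continuous_symbol hν)
  have hf0 : f 0 = 0 := by simp [hf, symbol, symbolIntegrand]
  have key : ∀ s : ℝ, 0 < s → ∃ ρ : ℝ, 0 < ρ ∧ supRe (symbol ν) ρ = s := by
    intro s hs
    -- `Re Φ` reaches the level `s`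
    obtain ⟨ξ₁, hξ₁⟩ : ∃ ξ, s ≤ f ξ := by
      have h1 : ∀ᶠ ξ in Bornology.cobounded (EuclideanSpace ℝ (Fin d)),
          ((s : ℝ) : EReal) < ((f ξ / Real.log (1 + ‖ξ‖) : ℝ) : EReal) := by
        refine eventually_lt_of_lt_liminf ?_
        unfold HartmanWintner at hHW
        rw [hHW]
        exact EReal.coe_lt_top s
      have h2 : ∀ᶠ ξ in Bornology.cobounded (EuclideanSpace ℝ (Fin d)), Real.exp 1 ≤ ‖ξ‖ :=
        tendsto_norm_cobounded_atTop.eventually_ge_atTop _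
      obtain ⟨ξ, hξ, hξ'⟩ := (h1.and h2).exists
      refine ⟨ξ, ?_⟩
      have h3 : s < f ξ / Real.log (1 + ‖ξ‖) := by exact_mod_cast hξ
      have h4 : 1 ≤ Real.log (1 + ‖ξ‖) := by
        rw [Real.le_log_iff_exp_le (by positivity)]; linarith
      rw [lt_div_iff₀ (by linarith)] at h3
      nlinarith
    have hclosed : IsClosed {ξ | s ≤ f ξ} := isClosed_le continuous_const hfc
    obtain ⟨ξ₂, hξ₂, hmin⟩ := hclosed.exists_infDist_eq_dist ⟨ξ₁, hξ₁⟩ 0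
    have hlt : ∀ η, ‖η‖ < ‖ξ₂‖ → f η < s := by
      intro η hη
      by_contra! hcon
      have := Metric.infDist_le_dist_of_mem (x := (0 : EuclideanSpace ℝ (Fin d)))
        (show η ∈ {ξ | s ≤ f ξ} from hcon)
      rw [hmin, dist_zero_left, dist_zero_left] at this
      linarith
    have hpos : 0 < ‖ξ₂‖ := by
      rw [norm_pos_iff]
      rintro rfl
      have : s ≤ f 0 := hξ₂
      linarith
    have hle : ∀ η ∈ Metric.closedBall (0 : EuclideanSpace ℝ (Fin d)) ‖ξ₂‖, f η ≤ s := by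
      have hsub : Metric.ball (0 : EuclideanSpace ℝ (Fin d)) ‖ξ₂‖ ⊆ {η | f η ≤ s} :=
        fun η hη => (hlt η (by simpa using hη)).le
      have := closure_minimal hsub (isClosed_le hfc continuous_const)
      rw [closure_ball _ hpos.ne'] at this
      exact fun η hη => this hη
    refine ⟨‖ξ₂‖, hpos, le_antisymm ?_ ?_⟩
    · refine csSup_le ⟨f 0, 0, by simp, rfl⟩ ?_
      rintro _ ⟨η, hη, rfl⟩
      exact hle η hη
    · refine le_csSup_of_le ⟨s, ?_⟩ ⟨ξ₂, by simp, rfl⟩ hξ₂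
      rintro _ ⟨η, hη, rfl⟩
      exact hle η hη
  choose! ψ hψ using key
  exact ⟨ψ, hψ⟩

end LevyGradient

/-! The proof works at the spatial scale `1 / R` with `R = ψ (1 / t)`, so that `φ R = 1 / t`. The
variable `R • X_t` has exponent `t Φ(Rη)`, whose real part is at most `1` on the unit ball.
Averaging `1 - cos⟨η, z⟩` over segments in the coordinate directions then bounds `∫ min 1 |z|²` for
the rescaled jump measure by `40 d`, uniformly in `t` (`lintegral_min_one_norm_sq_le`).

Hence the rescaled jumps of size at least `1` form a finite measure of mass at most `40 d`. They
contribute a compound Poisson factor and change the real part of the exponent by a bounded amount;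
moving the compensation radius from `R` to `1` only adds a drift. The remaining small-jump exponent
`Ψ` is smooth, with derivatives controlled by the second moment alone, and `(*)` rescales to a bound
on `∫ (1 + |η|)^(d+2) e^{-Re Ψ}`.

A translation by `h` multiplies the Fourier side by `e^{i⟨ξ,h⟩} - 1`. The function `(e^{i⟨ξ,h⟩} - 1)
e^{-Ψ}` has `d + 1` derivatives of `L¹` norm `O(|h|)`, so its Fourier transform is `O(|h| (1 +
|w|)^{-(d+1)})` and has `L¹` norm `O(|h|)` (`exists_integral_norm_fourier_incrementSymbol_le`).
Convolution with a probability law does not increase total mass, so the law of `R • X_t` moves by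
`O(|h|)` in total variation under translation by `h`. This is the Lipschitz bound for `P_t u` with
constant `C ‖u‖ R`, and `C` depends only on `d` and `c₀`. Each `t` is treated separately, so small
and large times need no different argument. -/

namespace LevyGradient

set_option linter.unusedSectionVars false

/-! ### Smoothness of the exponent of the small jumps. -/

section SmallJumps

variable {E F : Type*} [NormedAddCommGroup E] [InnerProductSpace ℝ E] [FiniteDimensional ℝ E]
  [MeasurableSpace E] [BorelSpace E] [NormedAddCommGroup F] [NormedSpace ℂ F]

lemma continuous_innerSL_smulRight {f : E → F} (hf : Continuous f) :
    Continuous fun z : E => (innerSL ℝ z).smulRight (f z) :=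
  (ContinuousLinearMap.smulRightL ℝ E F).continuous₂.comp₂ (innerSL ℝ).continuous hf

/-- Each derivative in `ξ` costs one factor `z`, and the growth `|s| ^ j` of `a'` at `s = ⟨ξ, z⟩`
costs `j` more. The values of `f` are vectors so that the lemma can be iterated: it serves with `j =
1`, `f = 1` for the exponent and with `j = 0`, `‖f z‖ = ‖z‖` for its derivative. Both times the
domination needs exactly the second moment. -/
lemma hasFDerivAt_integral_comp_inner {m : Measure E} {a a' : ℝ → ℂ} {f : E → F} {C : ℝ} {j : ℕ}
    (ha : ∀ s, HasDerivAt a (a' s) s) (ha' : Continuous a') (hbound : ∀ s, ‖a' s‖ ≤ C * |s| ^ j)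
    (hf : Continuous f) (hint : ∀ ξ, Integrable (fun z => a (inner ℝ ξ z) • f z) m)
    (hfint : Integrable (fun z => ‖z‖ ^ (j + 1) * ‖f z‖) m) (ξ : E) :
    HasFDerivAt (fun ξ => ∫ z, a (inner ℝ ξ z) • f z ∂m)
      (∫ z, a' (inner ℝ ξ z) • (innerSL ℝ z).smulRight (f z) ∂m) ξ := by
  have hC : 0 ≤ C := by
    have := (norm_nonneg _).trans (hbound 1)
    simpa using this
  have hm : Continuous fun z : E => (innerSL ℝ z).smulRight (f z) := continuous_innerSL_smulRight hf
  refine hasFDerivAt_integral_of_dominated_of_fderiv_le (s := Metric.ball ξ 1)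
    (F' := fun η z => a' (inner ℝ η z) • (innerSL ℝ z).smulRight (f z))
    (bound := fun z => C * (‖ξ‖ + 1) ^ j * (‖z‖ ^ (j + 1) * ‖f z‖))
    (Metric.ball_mem_nhds ξ one_pos) (Eventually.of_forall fun η => (hint η).1) (hint ξ)
    (Continuous.aestronglyMeasurable ?_) ?_ (hfint.const_mul _) ?_
  · exact (ha'.comp (continuous_const.inner continuous_id)).smul hm
  · refine Eventually.of_forall fun z η hη => ?_
    have h1 : ‖η‖ ≤ ‖ξ‖ + 1 := by
      have := norm_sub_norm_le η ξ
      rw [mem_ball_iff_norm] at hη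
      linarith
    rw [norm_smul, ContinuousLinearMap.norm_smulRight_apply, innerSL_apply_norm]
    calc ‖a' (inner ℝ η z)‖ * (‖z‖ * ‖f z‖)
        ≤ (C * ((‖ξ‖ + 1) * ‖z‖) ^ j) * (‖z‖ * ‖f z‖) := by
          gcongr
          refine (hbound _).trans ?_
          gcongr
          exact (abs_real_inner_le_norm η z).trans (by gcongr)
      _ = _ := by rw [mul_pow, pow_succ]; ring
  · refine Eventually.of_forall fun z η _ => ?_
    have h1 : HasFDerivAt (fun η : E => (inner ℝ η z : ℝ)) (innerSL ℝ z) η := by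
      have := (innerSL ℝ z).hasFDerivAt (x := η)
      refine this.congr_of_eventuallyEq (Eventually.of_forall fun y => ?_)
      simp [real_inner_comm]
    have h2 := ((ha (inner ℝ η z)).hasFDerivAt.comp η h1).smul_const (f z)
    refine h2.congr_fderiv ?_
    refine ContinuousLinearMap.ext fun (y : E) => ?_
    change ((inner ℝ z y : ℝ) • a' (inner ℝ η z)) • f z
      = a' (inner ℝ η z) • ((inner ℝ z y : ℝ) • f z)
    rw [smul_comm (a' _), smul_assoc]

/-- The characteristic exponent of a compensated jump measure with integrable second moment. -/
noncomputable def compensatedExponent (m : Measure E) (ξ : E) : ℂ :=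
  ∫ z, (1 - Complex.exp (Complex.I * ((inner ℝ ξ z : ℝ) : ℂ))
    + Complex.I * ((inner ℝ ξ z : ℝ) : ℂ)) ∂m

lemma norm_exp_I_mul_ofReal (s : ℝ) : ‖Complex.exp (Complex.I * (s : ℂ))‖ = 1 := by
  rw [mul_comm]; exact Complex.norm_exp_ofReal_mul_I _

lemma norm_exp_I_mul_ofReal_sub_one_le (s : ℝ) :
    ‖Complex.exp (Complex.I * (s : ℂ)) - 1‖ ≤ |s| := by
  simpa using Real.norm_exp_I_mul_ofReal_sub_one_le (x := s)

lemma norm_compensated_exp_le (a : ℝ) :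
    ‖1 - Complex.exp (Complex.I * (a : ℂ)) + Complex.I * (a : ℂ)‖ ≤ 3 * a ^ 2 := by
  have hIa : ‖Complex.I * (a : ℂ)‖ = |a| := by simp
  rcases le_or_gt |a| 1 with h | h
  · have h2 := Complex.norm_exp_sub_one_sub_id_le (x := Complex.I * (a : ℂ)) (by rwa [hIa])
    have e : 1 - Complex.exp (Complex.I * (a : ℂ)) + Complex.I * (a : ℂ)
        = -(Complex.exp (Complex.I * (a : ℂ)) - 1 - Complex.I * (a : ℂ)) := by ring
    rw [e, norm_neg]
    rw [hIa, sq_abs] at h2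
    nlinarith [sq_nonneg a]
  · have h2 := norm_add_le (1 - Complex.exp (Complex.I * (a : ℂ))) (Complex.I * (a : ℂ))
    have h3 := norm_exp_I_mul_ofReal_sub_one_le a
    rw [norm_sub_rev] at h3
    rw [hIa] at h2
    have h4 : a ^ 2 = |a| ^ 2 := (sq_abs a).symm
    nlinarith

lemma integrable_compensated_exp {m : Measure E} (hm : Integrable (fun z => ‖z‖ ^ 2) m) (ξ : E) :
    Integrable (fun z => 1 - Complex.exp (Complex.I * ((inner ℝ ξ z : ℝ) : ℂ))
      + Complex.I * ((inner ℝ ξ z : ℝ) : ℂ)) m := by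
  refine (hm.const_mul (3 * ‖ξ‖ ^ 2)).mono' (Continuous.aestronglyMeasurable (by fun_prop))
    (Eventually.of_forall fun z => (norm_compensated_exp_le _).trans ?_)
  have hin : |inner ℝ ξ z| ≤ ‖ξ‖ * ‖z‖ := abs_real_inner_le_norm ξ z
  have hsq : (inner ℝ ξ z) ^ 2 ≤ ‖ξ‖ ^ 2 * ‖z‖ ^ 2 := by
    rw [← sq_abs, ← mul_pow]; gcongr
  linarith

lemma hasFDerivAt_compensatedExponent {m : Measure E} (hm : Integrable (fun z => ‖z‖ ^ 2) m)
    (ξ : E) : HasFDerivAt (compensatedExponent m)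
      (∫ z, (Complex.I - Complex.I * Complex.exp (Complex.I * ((inner ℝ ξ z : ℝ) : ℂ))) •
        (innerSL ℝ z).smulRight (1 : ℂ) ∂m) ξ := by
  have := hasFDerivAt_integral_comp_inner (m := m) (f := fun _ : E => (1 : ℂ)) (C := 1) (j := 1)
    (a := fun s => 1 - Complex.exp (Complex.I * (s : ℂ)) + Complex.I * (s : ℂ))
    (a' := fun s => Complex.I - Complex.I * Complex.exp (Complex.I * (s : ℂ)))
    (fun s => ?_) (by fun_prop) (fun s => ?_) continuous_const
    (fun ξ => by simpa using integrable_compensated_exp hm ξ) (by simpa using hm) ξ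
  · simp only [smul_eq_mul, mul_one] at this
    exact this
  · have h0 : HasDerivAt (fun s : ℝ => Complex.I * (s : ℂ)) Complex.I s := by
      simpa using (Complex.ofRealCLM.hasDerivAt (x := s)).const_mul Complex.I
    refine (((h0.cexp).const_sub 1).add h0).congr_deriv ?_
    ring
  · have : Complex.I - Complex.I * Complex.exp (Complex.I * (s : ℂ))
      = -Complex.I * (Complex.exp (Complex.I * (s : ℂ)) - 1) := by ring
    rw [this, norm_mul]
    simpa using norm_exp_I_mul_ofReal_sub_one_le s

/-- The second derivative of `compensatedExponent`. -/
noncomputable def compensatedExponentHessian (m : Measure E) (ξ : E) : E →L[ℝ] E →L[ℝ] ℂ :=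
  ∫ z, Complex.exp (Complex.I * ((inner ℝ ξ z : ℝ) : ℂ)) •
    (innerSL ℝ z).smulRight ((innerSL ℝ z).smulRight (1 : ℂ)) ∂m

lemma norm_one_sub_exp_smul_le (ξ z : E) :
    ‖(Complex.I - Complex.I * Complex.exp (Complex.I * ((inner ℝ ξ z : ℝ) : ℂ))) •
        (innerSL ℝ z).smulRight (1 : ℂ)‖ ≤ ‖ξ‖ * ‖z‖ ^ 2 := by
  have e : Complex.I - Complex.I * Complex.exp (Complex.I * ((inner ℝ ξ z : ℝ) : ℂ))
    = -Complex.I * (Complex.exp (Complex.I * ((inner ℝ ξ z : ℝ) : ℂ)) - 1) := by ring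
  have h := norm_exp_I_mul_ofReal_sub_one_le (inner ℝ ξ z)
  have hin : |inner ℝ ξ z| ≤ ‖ξ‖ * ‖z‖ := abs_real_inner_le_norm ξ z
  rw [norm_smul, ContinuousLinearMap.norm_smulRight_apply, innerSL_apply_norm, e, norm_mul]
  simp only [norm_neg, Complex.norm_I, one_mul, norm_one, mul_one]
  nlinarith [norm_nonneg z]

lemma integrable_one_sub_exp_smul {m : Measure E} (hm : Integrable (fun z => ‖z‖ ^ 2) m) (ξ : E) :
    Integrable (fun z =>
      (Complex.I - Complex.I * Complex.exp (Complex.I * ((inner ℝ ξ z : ℝ) : ℂ))) •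
        (innerSL ℝ z).smulRight (1 : ℂ)) m :=
  (hm.const_mul ‖ξ‖).mono' (Continuous.aestronglyMeasurable (by fun_prop))
    (Eventually.of_forall fun z => norm_one_sub_exp_smul_le ξ z)

lemma norm_fderiv_compensatedExponent_le {m : Measure E}
    (hm : Integrable (fun z => ‖z‖ ^ 2) m) (ξ : E) :
    ‖fderiv ℝ (compensatedExponent m) ξ‖ ≤ ‖ξ‖ * ∫ z, ‖z‖ ^ 2 ∂m := by
  rw [(hasFDerivAt_compensatedExponent hm ξ).fderiv, ← integral_const_mul]
  exact norm_integral_le_of_norm_le (hm.const_mul _)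
    (Eventually.of_forall fun z => norm_one_sub_exp_smul_le ξ z)

lemma hasFDerivAt_fderiv_compensatedExponent {m : Measure E}
    (hm : Integrable (fun z => ‖z‖ ^ 2) m) (ξ : E) :
    HasFDerivAt (fderiv ℝ (compensatedExponent m)) (compensatedExponentHessian m ξ) ξ := by
  have e : fderiv ℝ (compensatedExponent m) = fun ξ =>
      ∫ z, (Complex.I - Complex.I * Complex.exp (Complex.I * ((inner ℝ ξ z : ℝ) : ℂ))) •
        (innerSL ℝ z).smulRight (1 : ℂ) ∂m :=
    funext fun ξ => (hasFDerivAt_compensatedExponent hm ξ).fderiv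
  rw [e]
  refine hasFDerivAt_integral_comp_inner (m := m) (f := fun z : E => (innerSL ℝ z).smulRight (1 : ℂ))
    (C := 1) (j := 0)
    (a := fun s => Complex.I - Complex.I * Complex.exp (Complex.I * (s : ℂ)))
    (a' := fun s => Complex.exp (Complex.I * (s : ℂ)))
    (fun s => ?_) (by fun_prop) (fun s => ?_) (by fun_prop)
    (fun ξ => integrable_one_sub_exp_smul hm ξ) ?_ ξ
  · have h0 : HasDerivAt (fun s : ℝ => Complex.I * (s : ℂ)) Complex.I s := by
      simpa using (Complex.ofRealCLM.hasDerivAt (x := s)).const_mul Complex.I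
    refine (((h0.cexp).const_mul Complex.I).const_sub Complex.I).congr_deriv ?_
    linear_combination (-Complex.exp (Complex.I * (s : ℂ))) * Complex.I_mul_I
  · simp
  · simpa [ContinuousLinearMap.norm_smulRight_apply, innerSL_apply_norm, pow_two] using hm

/-- The inner product normalised so that its Fourier character is `exp (I * inner ξ z)`. -/
noncomputable def scaledInner (E : Type*) [NormedAddCommGroup E] [InnerProductSpace ℝ E] :
    E →L[ℝ] E →L[ℝ] ℝ :=
  (-(2 * Real.pi)⁻¹ : ℝ) • (innerSL ℝ : E →L[ℝ] E →L[ℝ] ℝ)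

lemma scaledInner_apply (z ξ : E) : scaledInner E z ξ = -(2 * Real.pi)⁻¹ * inner ℝ z ξ := rfl

lemma norm_scaledInner_le : ‖scaledInner E‖ ≤ (2 * Real.pi)⁻¹ := by
  refine ContinuousLinearMap.opNorm_le_bound₂ _ (by positivity) fun z ξ => ?_
  rw [scaledInner_apply, norm_mul, norm_neg, Real.norm_of_nonneg (by positivity), mul_assoc]
  gcongr
  exact norm_inner_le_norm z ξ

/-- The compensated exponent is not itself a Fourier integral, since `m` may be infinite near the
origin. Two derivatives produce the weight `|z|²`, which makes the measure finite, and the general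
theory of Fourier integrals gives all further derivatives. -/
lemma compensatedExponentHessian_eq_fourierIntegral (m : Measure E) :
    compensatedExponentHessian m = VectorFourier.fourierIntegral Real.fourierChar m
      (scaledInner E).toLinearMap₁₂
      (fun z => (innerSL ℝ z).smulRight ((innerSL ℝ z).smulRight (1 : ℂ))) := by
  ext1 ξ
  unfold compensatedExponentHessian VectorFourier.fourierIntegral
  congr 1
  ext1 z
  rw [Circle.smul_def, Real.fourierChar_apply]
  congr 2
  change _ = ((2 * Real.pi * -(scaledInner E z ξ) : ℝ) : ℂ) * Complex.I
  rw [scaledInner_apply, real_inner_comm ξ z]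
  push_cast
  field_simp

lemma integrable_pow_mul_of_norm_le_one {m : Measure E} (hm : Integrable (fun z => ‖z‖ ^ 2) m)
    (hone : ∀ᵐ z ∂m, ‖z‖ ≤ 1) (n : ℕ) :
    Integrable (fun z => ‖z‖ ^ n *
      ‖(innerSL ℝ z).smulRight ((innerSL ℝ z).smulRight (1 : ℂ))‖) m := by
  simp only [ContinuousLinearMap.norm_smulRight_apply, innerSL_apply_norm]
  refine hm.mono' (Continuous.aestronglyMeasurable (by fun_prop)) ?_
  filter_upwards [hone] with z hz
  rw [Real.norm_of_nonneg (by positivity)]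
  have := pow_le_one₀ (n := n) (norm_nonneg z) hz
  simp only [norm_one, mul_one]
  nlinarith [norm_nonneg z, mul_nonneg (norm_nonneg z) (norm_nonneg z)]

lemma contDiff_compensatedExponentHessian {m : Measure E}
    (hm : Integrable (fun z => ‖z‖ ^ 2) m) (hone : ∀ᵐ z ∂m, ‖z‖ ≤ 1) (n : ℕ) :
    ContDiff ℝ n (compensatedExponentHessian m) := by
  rw [compensatedExponentHessian_eq_fourierIntegral]
  exact VectorFourier.contDiff_fourierIntegral (N := n) _
    fun k _ => integrable_pow_mul_of_norm_le_one hm hone k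

/-- Further derivatives bring down powers of `z`, at most `1` in norm on the support of `m`. The
normalisation of `scaledInner` cancels the factors `2π`, so the bound does not depend on `n`. -/
lemma norm_iteratedFDeriv_compensatedExponentHessian_le {m : Measure E}
    (hm : Integrable (fun z => ‖z‖ ^ 2) m) (hone : ∀ᵐ z ∂m, ‖z‖ ≤ 1) (n : ℕ) (ξ : E) :
    ‖iteratedFDeriv ℝ n (compensatedExponentHessian m) ξ‖ ≤ ∫ z, ‖z‖ ^ 2 ∂m := by
  rw [compensatedExponentHessian_eq_fourierIntegral,
    VectorFourier.iteratedFDeriv_fourierIntegral (N := n) _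
      (fun k _ => integrable_pow_mul_of_norm_le_one hm hone k)
      (continuous_innerSL_smulRight
        (continuous_innerSL_smulRight continuous_const)).aestronglyMeasurable le_rfl]
  refine (VectorFourier.norm_fourierIntegral_le_integral_norm _ _ _ _ _).trans ?_
  refine integral_mono_of_nonneg (Eventually.of_forall fun z => norm_nonneg _) hm ?_
  filter_upwards [hone] with z hz
  refine (VectorFourier.norm_fourierPowSMulRight_le _ _ _ _).trans ?_
  rw [ContinuousLinearMap.norm_smulRight_apply, ContinuousLinearMap.norm_smulRight_apply,
    innerSL_apply_norm]
  have h2 : (2 * Real.pi * ‖scaledInner E‖) ≤ 1 := by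
    calc _ ≤ 2 * Real.pi * (2 * Real.pi)⁻¹ := by gcongr; exact norm_scaledInner_le
      _ = 1 := mul_inv_cancel₀ (by positivity)
  calc _ = (2 * Real.pi * ‖scaledInner E‖) ^ n
          * ‖z‖ ^ n * ‖z‖ ^ 2 := by
        rw [mul_pow (2 * Real.pi)]; simp only [norm_one]; ring
    _ ≤ 1 * 1 * ‖z‖ ^ 2 := by
        gcongr
        · exact pow_le_one₀ (by positivity) h2
        · exact pow_le_one₀ (by positivity) hz
    _ = ‖z‖ ^ 2 := by ring

lemma contDiff_compensatedExponent {m : Measure E}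
    (hm : Integrable (fun z => ‖z‖ ^ 2) m) (hone : ∀ᵐ z ∂m, ‖z‖ ≤ 1) (n : ℕ) :
    ContDiff ℝ n (compensatedExponent m) := by
  have h1 : ContDiff ℝ (n + 1 : ℕ) (fderiv ℝ (compensatedExponent m)) := by
    push_cast
    refine contDiff_succ_iff_fderiv.2
      ⟨fun ξ => (hasFDerivAt_fderiv_compensatedExponent hm ξ).differentiableAt, by simp, ?_⟩
    rw [funext fun ξ => (hasFDerivAt_fderiv_compensatedExponent hm ξ).fderiv]
    exact contDiff_compensatedExponentHessian hm hone n
  have h2 : ContDiff ℝ ((n + 1 : ℕ) + 1) (compensatedExponent m) := by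
    refine contDiff_succ_iff_fderiv.2
      ⟨fun ξ => (hasFDerivAt_compensatedExponent hm ξ).differentiableAt, by simp, ?_⟩
    exact h1
  exact h2.of_le (by exact_mod_cast (show n ≤ n + 1 + 1 by omega))

/-- The first derivative grows at most linearly and all higher ones are bounded, so a single factor
of the base would suffice. The `n`-th power is the form required by the composition bound
`norm_iteratedFDeriv_comp_le`. -/
lemma norm_iteratedFDeriv_compensatedExponent_le {m : Measure E}
    (hm : Integrable (fun z => ‖z‖ ^ 2) m) (hone : ∀ᵐ z ∂m, ‖z‖ ≤ 1) {n : ℕ} (hn : 1 ≤ n) (ξ : E) :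
    ‖iteratedFDeriv ℝ n (compensatedExponent m) ξ‖ ≤
      ((1 + ∫ z, ‖z‖ ^ 2 ∂m) * (1 + ‖ξ‖)) ^ n := by
  have hI : 0 ≤ ∫ z, ‖z‖ ^ 2 ∂m := integral_nonneg fun z => by positivity
  set K := ∫ z, ‖z‖ ^ 2 ∂m
  have hbase : 1 ≤ (1 + K) * (1 + ‖ξ‖) := by nlinarith [norm_nonneg ξ]
  obtain ⟨k, rfl⟩ := Nat.exists_eq_add_of_le' hn
  refine le_trans ?_ (le_self_pow₀ hbase (by omega))
  rw [← norm_iteratedFDeriv_fderiv]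
  rcases k with _ | k
  · rw [norm_iteratedFDeriv_zero]
    refine (norm_fderiv_compensatedExponent_le hm ξ).trans ?_
    change ‖ξ‖ * K ≤ _
    nlinarith [norm_nonneg ξ]
  · rw [← norm_iteratedFDeriv_fderiv,
      funext fun ξ => (hasFDerivAt_fderiv_compensatedExponent hm ξ).fderiv]
    refine (norm_iteratedFDeriv_compensatedExponentHessian_le hm hone k ξ).trans ?_
    change K ≤ _
    nlinarith [norm_nonneg ξ]

end SmallJumps

/-! ### Integrable decay of the Fourier transform of the increment multiplier. -/

section Decay

variable {E : Type*} [NormedAddCommGroup E] [InnerProductSpace ℝ E] [FiniteDimensional ℝ E]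
  [MeasurableSpace E] [BorelSpace E]

/-- The real derivative of `exp` is `exp` followed by the multiplication map `ℂ → (ℂ →L[ℝ] ℂ)`,
which has norm at most `1`; induction on the order. -/
lemma norm_iteratedFDeriv_cexp_le (n : ℕ) (z : ℂ) :
    ‖iteratedFDeriv ℝ n Complex.exp z‖ ≤ ‖Complex.exp z‖ := by
  induction n with
  | zero => rw [norm_iteratedFDeriv_zero]
  | succ n ih =>
    have hcd : ContDiff ℝ n Complex.exp := Complex.contDiff_exp
    have e : fderiv ℝ Complex.exp = ContinuousLinearMap.mul ℝ ℂ ∘ Complex.exp := by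
      ext1 w
      rw [((Complex.hasDerivAt_exp w).hasFDerivAt.restrictScalars ℝ).fderiv]
      ext
      simp [mul_comm]
    rw [← norm_iteratedFDeriv_fderiv, e]
    refine ((ContinuousLinearMap.mul ℝ ℂ).norm_iteratedFDeriv_comp_left hcd.contDiffAt
      le_rfl).trans ?_
    exact (mul_le_of_le_one_left (norm_nonneg _) (ContinuousLinearMap.opNorm_mul_le ℝ ℂ)).trans ih

lemma norm_iteratedFDeriv_exp_neg_compensatedExponent_le {m : Measure E}
    (hm : Integrable (fun z => ‖z‖ ^ 2) m) (hone : ∀ᵐ z ∂m, ‖z‖ ≤ 1) (n : ℕ) (ξ : E) :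
    ‖iteratedFDeriv ℝ n (fun ξ => Complex.exp (-compensatedExponent m ξ)) ξ‖ ≤
      n.factorial * Real.exp (-(compensatedExponent m ξ).re) *
        ((1 + ∫ z, ‖z‖ ^ 2 ∂m) * (1 + ‖ξ‖)) ^ n := by
  have hcd : ContDiff ℝ n Complex.exp := Complex.contDiff_exp
  refine norm_iteratedFDeriv_comp_le (g := Complex.exp)
    (f := fun ξ => -compensatedExponent m ξ) hcd
    (contDiff_compensatedExponent hm hone n).neg le_rfl ξ (fun i _ => ?_) (fun i hi _ => ?_)
  · refine (norm_iteratedFDeriv_cexp_le i _).trans ?_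
    rw [Complex.norm_exp, Complex.neg_re]
  · change ‖iteratedFDeriv ℝ i (-compensatedExponent m) ξ‖ ≤ _
    rw [iteratedFDeriv_neg_apply, norm_neg]
    exact norm_iteratedFDeriv_compensatedExponent_le hm hone hi ξ

/-- The map `c ↦ (ξ ↦ i c ⟨h, ξ⟩)`. -/
noncomputable def innerMulI (h : E) : ℂ →L[ℝ] E →L[ℝ] ℂ :=
  (ContinuousLinearMap.smulRightL ℝ E ℂ (innerSL ℝ h)) ∘L (ContinuousLinearMap.mul ℝ ℂ Complex.I)

lemma innerMulI_apply (h ξ : E) (c : ℂ) :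
    innerMulI h c ξ = (inner ℝ h ξ : ℝ) • (Complex.I * c) := rfl

lemma norm_innerMulI_le (h : E) : ‖innerMulI h‖ ≤ ‖h‖ := by
  refine ContinuousLinearMap.opNorm_le_bound₂ _ (norm_nonneg _) fun c ξ => ?_
  rw [innerMulI_apply, norm_smul, norm_mul, Complex.norm_I, one_mul]
  have := norm_inner_le_norm (𝕜 := ℝ) h ξ
  nlinarith [norm_nonneg c]

lemma hasFDerivAt_exp_inner (h ξ : E) :
    HasFDerivAt (fun ξ : E => Complex.exp (Complex.I * ((inner ℝ ξ h : ℝ) : ℂ)))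
      (innerMulI h (Complex.exp (Complex.I * ((inner ℝ ξ h : ℝ) : ℂ)))) ξ := by
  have h1 : HasFDerivAt (fun η : E => (inner ℝ η h : ℝ)) (innerSL ℝ h) ξ := by
    have := (innerSL ℝ h).hasFDerivAt (x := ξ)
    refine this.congr_of_eventuallyEq (Eventually.of_forall fun y => ?_)
    simp [real_inner_comm]
  have h0 : HasDerivAt (fun s : ℝ => Complex.I * (s : ℂ)) Complex.I (inner ℝ ξ h) := by
    simpa using (Complex.ofRealCLM.hasDerivAt (x := inner ℝ ξ h)).const_mul Complex.I
  refine (h0.cexp.hasFDerivAt.comp ξ h1).congr_fderiv ?_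
  refine ContinuousLinearMap.ext fun y => ?_
  rw [innerMulI_apply, mul_comm Complex.I (Complex.exp _)]
  rfl

lemma contDiff_exp_inner (h : E) (n : ℕ) :
    ContDiff ℝ n (fun ξ : E => Complex.exp (Complex.I * ((inner ℝ ξ h : ℝ) : ℂ))) := by
  have h1 : ContDiff ℝ n (fun ξ : E => (inner ℝ ξ h : ℝ)) := contDiff_id.inner ℝ contDiff_const
  have h2 : ContDiff ℝ n (fun ξ : E => Complex.I * ((inner ℝ ξ h : ℝ) : ℂ)) :=
    contDiff_const.mul (Complex.ofRealCLM.contDiff.comp h1)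
  exact h2.cexp

lemma norm_iteratedFDeriv_exp_inner_le (h : E) (n : ℕ) (ξ : E) :
    ‖iteratedFDeriv ℝ n (fun ξ : E => Complex.exp (Complex.I * ((inner ℝ ξ h : ℝ) : ℂ))) ξ‖
      ≤ ‖h‖ ^ n := by
  induction n with
  | zero => rw [norm_iteratedFDeriv_zero, norm_exp_I_mul_ofReal, pow_zero]
  | succ n ih =>
    rw [← norm_iteratedFDeriv_fderiv, funext fun ξ => (hasFDerivAt_exp_inner h ξ).fderiv]
    refine ((innerMulI h).norm_iteratedFDeriv_comp_left (contDiff_exp_inner h n).contDiffAt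
      le_rfl).trans ?_
    rw [pow_succ']
    exact mul_le_mul (norm_innerMulI_le h) ih (norm_nonneg _) (norm_nonneg _)

/-- One factor `‖h‖` survives at every order. At order `0` it comes from `|e^{is} - 1| ≤ |s|`, at
the price of a factor `‖ξ‖`; at higher orders surplus powers of `‖h‖` are dropped. -/
lemma norm_iteratedFDeriv_exp_inner_sub_one_le {h : E} (hh : ‖h‖ ≤ 1) (n : ℕ) (ξ : E) :
    ‖iteratedFDeriv ℝ n (fun ξ : E => Complex.exp (Complex.I * ((inner ℝ ξ h : ℝ) : ℂ)) - 1) ξ‖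
      ≤ ‖h‖ * (1 + ‖ξ‖) := by
  rcases n with _ | n
  · rw [norm_iteratedFDeriv_zero]
    refine (norm_exp_I_mul_ofReal_sub_one_le _).trans ((abs_real_inner_le_norm ξ h).trans ?_)
    nlinarith [norm_nonneg h]
  · have e : (fderiv ℝ fun ξ : E => Complex.exp (Complex.I * ((inner ℝ ξ h : ℝ) : ℂ)) - 1) =
        innerMulI h ∘ fun ξ : E => Complex.exp (Complex.I * ((inner ℝ ξ h : ℝ) : ℂ)) :=
      funext fun ξ => ((hasFDerivAt_exp_inner h ξ).sub_const 1).fderiv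
    rw [← norm_iteratedFDeriv_fderiv, e]
    refine ((innerMulI h).norm_iteratedFDeriv_comp_left (contDiff_exp_inner h n).contDiffAt
      le_rfl).trans ?_
    refine mul_le_mul (norm_innerMulI_le h) ((norm_iteratedFDeriv_exp_inner_le h n ξ).trans ?_)
      (norm_nonneg _) (norm_nonneg _)
    have := pow_le_one₀ (n := n) (norm_nonneg h) hh
    linarith [norm_nonneg ξ]

/-- The Fourier multiplier of the increment by `h` of the law with exponent
`compensatedExponent m`. -/
noncomputable def incrementSymbol (m : Measure E) (h ξ : E) : ℂ :=
  (Complex.exp (Complex.I * ((inner ℝ ξ h : ℝ) : ℂ)) - 1) *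
    Complex.exp (-compensatedExponent m ξ)

lemma contDiff_incrementSymbol {m : Measure E}
    (hm : Integrable (fun z => ‖z‖ ^ 2) m) (hone : ∀ᵐ z ∂m, ‖z‖ ≤ 1) (h : E) (n : ℕ) :
    ContDiff ℝ n (incrementSymbol m h) :=
  ((contDiff_exp_inner h n).sub contDiff_const).mul
    (contDiff_compensatedExponent hm hone n).neg.cexp

/-- Leibniz rule: the binomial coefficients sum to `2 ^ n`. The exponent is `n + 1` because the
factor `e^{i⟨ξ,h⟩} - 1` contributes one power of `1 + ‖ξ‖`. -/
lemma norm_iteratedFDeriv_incrementSymbol_le {m : Measure E}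
    (hm : Integrable (fun z => ‖z‖ ^ 2) m) (hone : ∀ᵐ z ∂m, ‖z‖ ≤ 1) {h : E} (hh : ‖h‖ ≤ 1)
    (n : ℕ) (ξ : E) :
    ‖iteratedFDeriv ℝ n (incrementSymbol m h) ξ‖ ≤
      2 ^ n * n.factorial * (1 + ∫ z, ‖z‖ ^ 2 ∂m) ^ n * ‖h‖ *
        ((1 + ‖ξ‖) ^ (n + 1) * Real.exp (-(compensatedExponent m ξ).re)) := by
  have hI : 0 ≤ ∫ z, ‖z‖ ^ 2 ∂m := integral_nonneg fun z => by positivity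
  refine (norm_iteratedFDeriv_mul_le (N := n) ((contDiff_exp_inner h n).sub contDiff_const)
    (contDiff_compensatedExponent hm hone n).neg.cexp ξ le_rfl).trans ?_
  have hterm : ∀ i ∈ Finset.range (n + 1), (n.choose i : ℝ) *
      ‖iteratedFDeriv ℝ i (fun ξ : E =>
        Complex.exp (Complex.I * ((inner ℝ ξ h : ℝ) : ℂ)) - 1) ξ‖ *
      ‖iteratedFDeriv ℝ (n - i) (fun ξ => Complex.exp (-compensatedExponent m ξ)) ξ‖ ≤
      (n.choose i : ℝ) * (n.factorial * (1 + ∫ z, ‖z‖ ^ 2 ∂m) ^ n * ‖h‖ *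
        ((1 + ‖ξ‖) ^ (n + 1) * Real.exp (-(compensatedExponent m ξ).re))) := by
    intro i _
    rw [mul_assoc]
    refine mul_le_mul_of_nonneg_left ?_ (by positivity)
    have hb : 1 ≤ (1 + ∫ z, ‖z‖ ^ 2 ∂m) * (1 + ‖ξ‖) := by nlinarith [norm_nonneg ξ]
    calc _ ≤ (‖h‖ * (1 + ‖ξ‖)) * (((n - i).factorial : ℝ) *
            Real.exp (-(compensatedExponent m ξ).re) *
            ((1 + ∫ z, ‖z‖ ^ 2 ∂m) * (1 + ‖ξ‖)) ^ (n - i)) :=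
          mul_le_mul (norm_iteratedFDeriv_exp_inner_sub_one_le hh i ξ)
            (norm_iteratedFDeriv_exp_neg_compensatedExponent_le hm hone (n - i) ξ)
            (norm_nonneg _) (by positivity)
      _ ≤ (‖h‖ * (1 + ‖ξ‖)) * ((n.factorial : ℝ) *
            Real.exp (-(compensatedExponent m ξ).re) *
            ((1 + ∫ z, ‖z‖ ^ 2 ∂m) * (1 + ‖ξ‖)) ^ n) := by
          gcongr
          · exact Nat.sub_le n i
          · exact Nat.sub_le n i
      _ = _ := by rw [mul_pow, pow_succ]; ring
  refine (Finset.sum_le_sum hterm).trans (le_of_eq ?_)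
  rw [← Finset.sum_mul, ← Nat.cast_sum, Nat.sum_range_choose]
  push_cast
  ring

-- Decay of order `d + 1` is integrable in dimension `d` and costs `d + 1` derivatives; together
-- with the extra power from the increment this gives the weight `d + 2`. The constant depends on
-- `m` only through `K` and `W`, which is what makes the final estimate uniform in `t`.
open FourierTransform in
lemma exists_integral_norm_fourier_incrementSymbol_le (E : Type*) [NormedAddCommGroup E]
    [InnerProductSpace ℝ E] [FiniteDimensional ℝ E] [MeasurableSpace E] [BorelSpace E]
    (K W : ℝ) (hK : 0 ≤ K) (hW : 0 ≤ W) :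
    ∃ C : ℝ, 0 < C ∧ ∀ m : Measure E, Integrable (fun z => ‖z‖ ^ 2) m → (∀ᵐ z ∂m, ‖z‖ ≤ 1) →
      ∫ z, ‖z‖ ^ 2 ∂m ≤ K →
      Integrable (fun ξ : E => (1 + ‖ξ‖) ^ (Module.finrank ℝ E + 2) *
        Real.exp (-(compensatedExponent m ξ).re)) →
      ∫ ξ : E, (1 + ‖ξ‖) ^ (Module.finrank ℝ E + 2) *
        Real.exp (-(compensatedExponent m ξ).re) ≤ W →
      ∀ h : E, ‖h‖ ≤ 1 → Integrable (incrementSymbol m h) ∧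
        Integrable (𝓕 (incrementSymbol m h)) ∧
        ∫ w, ‖𝓕 (incrementSymbol m h) w‖ ≤ C * ‖h‖ := by
  set d := Module.finrank ℝ E with hd
  set A : ℝ := 2 ^ (d + 1) * (d + 1).factorial * (1 + K) ^ (d + 1) * W
  set J : ℝ := ∫ w : E, (1 + ‖w‖) ^ (-((d + 1 : ℕ) : ℝ))
  have hJi : Integrable (fun w : E => (1 + ‖w‖) ^ (-((d + 1 : ℕ) : ℝ))) :=
    integrable_one_add_norm (by push_cast; linarith)
  have hJ : 0 ≤ J := integral_nonneg fun w => by positivity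
  have hA : 0 ≤ A := by positivity
  -- `A * ‖h‖` bounds the `L¹` norm of every derivative of order at most `d + 1`. The outer power of
  -- `2` comes from comparing `(1 + ‖w‖)^(d+1)` with `1 + ‖w‖^(d+1)`, the inner one from the Fourier
  -- derivative estimate, and `d + 2` counts the orders `0, …, d + 1`.
  set B : ℝ := 2 ^ (d + 1) * (A + 2 ^ (d + 1) * ((d + 2 : ℕ) * A))
  refine ⟨B * J + 1, by positivity, fun m hm hone hmK hint hintW h hh => ?_⟩
  have hI : 0 ≤ ∫ z, ‖z‖ ^ 2 ∂m := integral_nonneg fun z => by positivity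
  have hcd := contDiff_incrementSymbol hm hone h
  have hpt : ∀ n ≤ d + 1, ∀ ξ, ‖iteratedFDeriv ℝ n (incrementSymbol m h) ξ‖ ≤
      2 ^ (d + 1) * (d + 1).factorial * (1 + K) ^ (d + 1) * ‖h‖ *
        ((1 + ‖ξ‖) ^ (d + 2) * Real.exp (-(compensatedExponent m ξ).re)) := by
    intro n hn ξ
    refine (norm_iteratedFDeriv_incrementSymbol_le hm hone hh n ξ).trans ?_
    gcongr ?_ * (?_ : ℝ) * ?_ * _ * (?_ * _)
    · exact pow_le_pow_right₀ (by norm_num) hn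
    · exact_mod_cast Nat.factorial_le hn
    · calc (1 + ∫ z, ‖z‖ ^ 2 ∂m) ^ n ≤ (1 + K) ^ n := by gcongr
        _ ≤ (1 + K) ^ (d + 1) := pow_le_pow_right₀ (by linarith) hn
    · exact pow_le_pow_right₀ (by linarith [norm_nonneg ξ]) (by omega)
  have hDi : ∀ n ≤ d + 1, Integrable (fun ξ => ‖iteratedFDeriv ℝ n (incrementSymbol m h) ξ‖) := by
    intro n hn
    refine (hint.const_mul
      (2 ^ (d + 1) * (d + 1).factorial * (1 + K) ^ (d + 1) * ‖h‖)).mono' ?_ ?_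
    · exact ((hcd n).continuous_iteratedFDeriv le_rfl).norm.aestronglyMeasurable
    · exact Eventually.of_forall fun ξ => by simpa using hpt n hn ξ
  have hDb : ∀ n ≤ d + 1, ∫ ξ, ‖iteratedFDeriv ℝ n (incrementSymbol m h) ξ‖ ≤ A * ‖h‖ := by
    intro n hn
    calc _ ≤ ∫ ξ : E, 2 ^ (d + 1) * (d + 1).factorial * (1 + K) ^ (d + 1) * ‖h‖ *
        ((1 + ‖ξ‖) ^ (d + 2) * Real.exp (-(compensatedExponent m ξ).re)) :=
          integral_mono (hDi n hn) (hint.const_mul _) (hpt n hn)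
      _ ≤ 2 ^ (d + 1) * (d + 1).factorial * (1 + K) ^ (d + 1) * ‖h‖ * W := by
          rw [integral_const_mul]; gcongr
      _ = A * ‖h‖ := by ring
  have hGi : Integrable (incrementSymbol m h) := by
    have := hDi 0 (by omega)
    simp only [norm_iteratedFDeriv_zero] at this
    exact (integrable_norm_iff (hcd 0).continuous.aestronglyMeasurable).1 this
  have hdecay : ∀ w : E, ‖𝓕 (incrementSymbol m h) w‖ ≤
      (B * ‖h‖) * (1 + ‖w‖) ^ (-((d + 1 : ℕ) : ℝ)) := by
    intro w
    have h0 : ‖𝓕 (incrementSymbol m h) w‖ ≤ A * ‖h‖ := by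
      refine (VectorFourier.norm_fourierIntegral_le_integral_norm _ _ _ _ _).trans ?_
      simpa using hDb 0 (by omega)
    have h1 : ‖w‖ ^ (d + 1) * ‖𝓕 (incrementSymbol m h) w‖ ≤
        2 ^ (d + 1) * ((d + 2 : ℕ) * A) * ‖h‖ := by
      have := Real.pow_mul_norm_iteratedFDeriv_fourier_le (K := 0) (N := (d + 1 : ℕ))
        (hcd (d + 1)) (fun k n hk hn => by
          have hk0 : k = 0 := by simpa using hk
          subst hk0
          simpa using hDi n (by exact_mod_cast hn)) (k := 0) (n := d + 1) le_rfl le_rfl w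
      rw [norm_iteratedFDeriv_zero] at this
      refine this.trans ?_
      have hsum : ∑ p ∈ Finset.range (0 + 1) ×ˢ Finset.range (d + 1 + 1),
          ∫ v, ‖v‖ ^ p.1 * ‖iteratedFDeriv ℝ p.2 (incrementSymbol m h) v‖ ≤
          (d + 2 : ℕ) * (A * ‖h‖) := by
        refine (Finset.sum_le_card_nsmul _ _ (A * ‖h‖) fun p hp => ?_).trans ?_
        · obtain ⟨hp1, hp2⟩ := Finset.mem_product.1 hp
          have e : p.1 = 0 := by simpa using hp1
          simp only [e, pow_zero, one_mul]
          exact hDb _ (by simpa [Nat.lt_succ_iff] using hp2)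
        · rw [Finset.card_product, Finset.card_range, Finset.card_range, nsmul_eq_mul, zero_add,
            one_mul]
      simp only [pow_zero, one_mul, CharP.cast_eq_zero, mul_zero, zero_add]
      calc _ ≤ (2 : ℝ) ^ (d + 1) * ((d + 2 : ℕ) * (A * ‖h‖)) := by gcongr
        _ = _ := by ring
    have h2 : (1 + ‖w‖) ^ (d + 1) ≤ 2 ^ (d + 1) * (1 + ‖w‖ ^ (d + 1)) := by
      rcases le_total ‖w‖ 1 with hw | hw
      · calc (1 + ‖w‖) ^ (d + 1) ≤ 2 ^ (d + 1) := by gcongr; linarith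
          _ ≤ _ := le_mul_of_one_le_right (by positivity) (by
            linarith [pow_nonneg (norm_nonneg w) (d + 1)])
      · calc (1 + ‖w‖) ^ (d + 1) ≤ (2 * ‖w‖) ^ (d + 1) := by gcongr; linarith
          _ = 2 ^ (d + 1) * ‖w‖ ^ (d + 1) := mul_pow _ _ _
          _ ≤ _ := by gcongr; linarith
    rw [Real.rpow_neg (by positivity), Real.rpow_natCast, ← div_eq_mul_inv,
      le_div_iff₀ (by positivity)]
    calc ‖𝓕 (incrementSymbol m h) w‖ * (1 + ‖w‖) ^ (d + 1)
        ≤ ‖𝓕 (incrementSymbol m h) w‖ * (2 ^ (d + 1) * (1 + ‖w‖ ^ (d + 1))) := by gcongr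
      _ = 2 ^ (d + 1) * (‖𝓕 (incrementSymbol m h) w‖ +
          ‖w‖ ^ (d + 1) * ‖𝓕 (incrementSymbol m h) w‖) := by ring
      _ ≤ 2 ^ (d + 1) * (A * ‖h‖ + 2 ^ (d + 1) * ((d + 2 : ℕ) * A) * ‖h‖) := by gcongr
      _ = B * ‖h‖ := by ring
  have hFc : Continuous (𝓕 (incrementSymbol m h)) :=
    VectorFourier.fourierIntegral_continuous Real.continuous_fourierChar
      (by exact continuous_inner) hGi
  refine ⟨hGi, (hJi.const_mul _).mono' hFc.aestronglyMeasurable (Eventually.of_forall hdecay), ?_⟩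
  calc _ ≤ ∫ w : E, (B * ‖h‖) * (1 + ‖w‖) ^ (-((d + 1 : ℕ) : ℝ)) :=
        integral_mono_of_nonneg (Eventually.of_forall fun _ => norm_nonneg _)
          (hJi.const_mul _) (Eventually.of_forall hdecay)
    _ = B * J * ‖h‖ := by rw [integral_const_mul]; ring
    _ ≤ (B * J + 1) * ‖h‖ := by nlinarith [norm_nonneg h]

end Decay

/-! ### Translation estimates for laws with a small-jump factor. -/

section Increments

variable {E : Type*} [NormedAddCommGroup E] [InnerProductSpace ℝ E] [FiniteDimensional ℝ E]
  [MeasurableSpace E] [BorelSpace E]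

lemma conj_exp_I_mul_ofReal (s : ℝ) : (starRingEnd ℂ) (Complex.exp (Complex.I * (s : ℂ)))
    = Complex.exp (Complex.I * ((-s : ℝ) : ℂ)) := by
  rw [← Complex.exp_conj, map_mul, Complex.conj_I, Complex.conj_ofReal]
  push_cast
  ring_nf

lemma conj_compensatedExponent (m : Measure E) (ξ : E) :
    (starRingEnd ℂ) (compensatedExponent m ξ) = compensatedExponent m (-ξ) := by
  unfold compensatedExponent
  rw [← integral_conj]
  refine integral_congr_ae (Eventually.of_forall fun z => ?_)
  simp only [map_add, map_sub, map_one, conj_exp_I_mul_ofReal, map_mul, Complex.conj_I,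
    Complex.conj_ofReal, inner_neg_left]
  push_cast
  ring

lemma conj_incrementSymbol (m : Measure E) (h ξ : E) :
    (starRingEnd ℂ) (incrementSymbol m h ξ) = incrementSymbol m h (-ξ) := by
  unfold incrementSymbol
  rw [map_mul, map_sub, map_one, conj_exp_I_mul_ofReal, ← Complex.exp_conj, map_neg,
    conj_compensatedExponent, inner_neg_left]

open FourierTransform in
lemma fourier_im_eq_zero {G : E → ℂ} (hG : ∀ ξ, (starRingEnd ℂ) (G ξ) = G (-ξ)) (w : E) :
    (𝓕 G w).im = 0 := by
  rw [← Complex.conj_eq_iff_im, Real.fourier_eq', ← integral_conj,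
    ← integral_neg_eq_self (fun v => Complex.exp (((-2 * Real.pi * inner ℝ v w : ℝ) : ℂ) * Complex.I)
      • G v)]
  refine integral_congr_ae (Eventually.of_forall fun v => ?_)
  simp only [smul_eq_mul, map_mul, hG, ← Complex.exp_conj, Complex.conj_I, Complex.conj_ofReal,
    inner_neg_left]
  push_cast
  ring_nf

open FourierTransform in
/-- An integrable Hermitian function with integrable Fourier transform is a difference of
characteristic functions of finite measures. -/
lemma exists_charFun_sub_charFun_eq {G : E → ℂ} (hGc : Continuous G) (hGi : Integrable G)
    (hFi : Integrable (𝓕 G)) (hG : ∀ ξ, (starRingEnd ℂ) (G ξ) = G (-ξ)) :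
    ∃ p q : Measure E, IsFiniteMeasure p ∧ IsFiniteMeasure q ∧
      (∀ ξ, charFun p ξ - charFun q ξ = G ξ) ∧
      p.real Set.univ ≤ ∫ w, ‖𝓕 G w‖ ∧ q.real Set.univ ≤ ∫ w, ‖𝓕 G w‖ := by
  have hFc : Continuous (𝓕 G) :=
    VectorFourier.fourierIntegral_continuous Real.continuous_fourierChar
      (by exact continuous_inner) hGi
  set r : E → ℝ := fun w => (𝓕 G w).re
  have hrc : Continuous r := Complex.continuous_re.comp hFc
  have hr : ∀ w, 𝓕 G w = (r w : ℂ) := fun w =>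
    Complex.ext rfl (by rw [fourier_im_eq_zero hG w, Complex.ofReal_im])
  have hr_le : ∀ w, |r w| ≤ ‖𝓕 G w‖ := fun w => Complex.abs_re_le_norm _
  have key : ∀ s : E → ℝ, Continuous s → (∀ w, |s w| ≤ ‖𝓕 G w‖) →
      (volume.withDensity fun w => ENNReal.ofReal (s w)) Set.univ
        ≤ ENNReal.ofReal (∫ w, ‖𝓕 G w‖) := by
    intro s _ hs
    rw [withDensity_apply _ MeasurableSet.univ, Measure.restrict_univ,
      ofReal_integral_norm_eq_lintegral_enorm hFi]
    refine lintegral_mono fun w => ?_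
    rw [← ofReal_norm]
    exact ENNReal.ofReal_le_ofReal ((le_abs_self _).trans (hs w))
  have keyI : ∀ s : E → ℝ, Continuous s → (∀ w, |s w| ≤ ‖𝓕 G w‖) → ∀ f : E → ℂ, Continuous f →
      (∀ w, ‖f w‖ ≤ 1) → Integrable (fun w => ((max (s w) 0 : ℝ) : ℂ) * f w) := by
    intro s hsc hs f hf hf1
    refine hFi.norm.mono' (Continuous.aestronglyMeasurable (by fun_prop))
      (Eventually.of_forall fun w => ?_)
    rw [norm_mul, Complex.norm_real, Real.norm_of_nonneg (le_max_right _ _)]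
    calc max (s w) 0 * ‖f w‖ ≤ max (s w) 0 * 1 := by
          have := hf1 w; gcongr
      _ ≤ |s w| := by rw [mul_one]; exact max_le (le_abs_self _) (abs_nonneg _)
      _ ≤ _ := hs w
  have keyE : ∀ s : E → ℝ, Continuous s → ∀ ξ,
      charFun (volume.withDensity fun w => ENNReal.ofReal (s w)) ξ =
        ∫ w, ((max (s w) 0 : ℝ) : ℂ) * Complex.exp ((inner ℝ w ξ : ℝ) * Complex.I) := by
    intro s hsc ξ
    rw [charFun_apply, integral_withDensity_eq_integral_toReal_smul (by fun_prop)
      (Eventually.of_forall fun w => ENNReal.ofReal_lt_top)]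
    refine integral_congr_ae (Eventually.of_forall fun w => ?_)
    simp only [ENNReal.toReal_ofReal', Complex.real_smul]
  have hneg_c : Continuous fun w => -r w := hrc.neg
  have hneg_le : ∀ w, |-r w| ≤ ‖𝓕 G w‖ := fun w => by rw [abs_neg]; exact hr_le w
  -- `ENNReal.ofReal` truncates at `0`, so the two densities are the positive and negative parts of
  -- the real function `𝓕 G`.
  set p₀ : Measure E := volume.withDensity fun w => ENNReal.ofReal (r w)
  set q₀ : Measure E := volume.withDensity fun w => ENNReal.ofReal (-r w)
  have hp₀ : IsFiniteMeasure p₀ := ⟨(key r hrc hr_le).trans_lt ENNReal.ofReal_lt_top⟩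
  have hq₀ : IsFiniteMeasure q₀ :=
    ⟨(key _ hneg_c hneg_le).trans_lt ENNReal.ofReal_lt_top⟩
  have hmeas : Measurable fun w : E => (2 * Real.pi) • w := by fun_prop
  -- The dilation by `2π` passes from the character `e^{2πi⟨w,ξ⟩}` of Fourier inversion to the
  -- character `e^{i⟨w,ξ⟩}` of `charFun`.
  refine ⟨p₀.map fun w => (2 * Real.pi) • w, q₀.map fun w => (2 * Real.pi) • w,
    inferInstance, inferInstance, fun ξ => ?_, ?_, ?_⟩
  · rw [charFun_map_smul, charFun_map_smul, keyE r hrc, keyE _ hneg_c, ← integral_sub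
      (keyI r hrc hr_le _ (by fun_prop) fun w => (Complex.norm_exp_ofReal_mul_I _).le)
      (keyI _ hneg_c hneg_le _ (by fun_prop) fun w => (Complex.norm_exp_ofReal_mul_I _).le)]
    rw [← congrFun (hGc.fourierInv_fourier_eq hGi hFi) ξ, Real.fourierInv_eq']
    refine integral_congr_ae (Eventually.of_forall fun w => ?_)
    simp only [hr w, smul_eq_mul, inner_smul_right]
    rw [← sub_mul, mul_comm]
    congr 1
    rw [← Complex.ofReal_sub, Complex.ofReal_inj]
    rcases le_total (r w) 0 with h | h
    · rw [max_eq_right h, max_eq_left (by linarith)]; ring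
    · rw [max_eq_left h, max_eq_right (by linarith)]; ring
  · rw [measureReal_def, Measure.map_apply hmeas MeasurableSet.univ, Set.preimage_univ]
    exact ENNReal.toReal_le_of_le_ofReal (integral_nonneg fun _ => norm_nonneg _)
      (key r hrc hr_le)
  · rw [measureReal_def, Measure.map_apply hmeas MeasurableSet.univ, Set.preimage_univ]
    exact ENNReal.toReal_le_of_le_ofReal (integral_nonneg fun _ => norm_nonneg _)
      (key _ hneg_c hneg_le)

/-- Convolution powers of a measure. -/
noncomputable def convPow (m : Measure E) : ℕ → Measure E
  | 0 => Measure.dirac 0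
  | n + 1 => convPow m n ∗ m

instance isFiniteMeasure_convPow (m : Measure E) [IsFiniteMeasure m] (n : ℕ) :
    IsFiniteMeasure (convPow m n) := by
  induction n with
  | zero => unfold convPow; infer_instance
  | succ n ih => unfold convPow; infer_instance

lemma charFun_convPow (m : Measure E) [IsFiniteMeasure m] (n : ℕ) (ξ : E) :
    charFun (convPow m n) ξ = charFun m ξ ^ n := by
  induction n with
  | zero => simp [convPow, charFun_dirac]
  | succ n ih => rw [convPow, charFun_conv, ih, pow_succ]

lemma convPow_real_univ (m : Measure E) [IsFiniteMeasure m] (n : ℕ) :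
    (convPow m n).real Set.univ = m.real Set.univ ^ n := by
  have := charFun_convPow m n 0
  rw [charFun_zero, charFun_zero] at this
  exact_mod_cast this

/-- The compound Poisson law with finite jump measure `m`. -/
noncomputable def compoundPoisson (m : Measure E) : Measure E :=
  Measure.sum fun n : ℕ =>
    ENNReal.ofReal (Real.exp (-m.real Set.univ) / n.factorial) • convPow m n

instance isProbabilityMeasure_compoundPoisson (m : Measure E) [IsFiniteMeasure m] :
    IsProbabilityMeasure (compoundPoisson m) := by
  have hs : HasSum (fun n : ℕ => Real.exp (-m.real Set.univ) / n.factorial *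
      m.real Set.univ ^ n) 1 := by
    have h := (NormedSpace.expSeries_div_hasSum_exp (m.real Set.univ)).mul_left
      (Real.exp (-m.real Set.univ))
    rw [← Real.exp_eq_exp_ℝ, ← Real.exp_add, neg_add_cancel, Real.exp_zero] at h
    rw [show (fun n : ℕ => Real.exp (-m.real Set.univ) / n.factorial * m.real Set.univ ^ n) =
      fun n : ℕ => Real.exp (-m.real Set.univ) * (m.real Set.univ ^ n / n.factorial) from
      funext fun n => by ring]
    exact h
  refine ⟨?_⟩
  rw [compoundPoisson, Measure.sum_apply _ MeasurableSet.univ]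
  have e : ∀ n : ℕ, (ENNReal.ofReal (Real.exp (-m.real Set.univ) / n.factorial) • convPow m n)
      Set.univ = ENNReal.ofReal (Real.exp (-m.real Set.univ) / n.factorial *
        m.real Set.univ ^ n) := fun n => by
    rw [Measure.smul_apply, smul_eq_mul, ENNReal.ofReal_mul (by positivity), ← convPow_real_univ,
      ofReal_measureReal]
  simp_rw [e]
  rw [← ENNReal.ofReal_tsum_of_nonneg (fun n => by positivity) hs.summable, hs.tsum_eq,
    ENNReal.ofReal_one]

/-- Convolution powers become powers of `charFun m`, so the Poisson mixture is an exponential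
series. This realises the large-jump factor as the characteristic function of a probability law. -/
lemma charFun_compoundPoisson (m : Measure E) [IsFiniteMeasure m] (ξ : E) :
    charFun (compoundPoisson m) ξ =
      Complex.exp (-∫ z, (1 - Complex.exp (Complex.I * ((inner ℝ ξ z : ℝ) : ℂ))) ∂m) := by
  have hi : Integrable (fun x : E => Complex.exp ((inner ℝ x ξ : ℝ) * Complex.I))
      (compoundPoisson m) :=
    (integrable_const (1 : ℝ)).mono' (Continuous.aestronglyMeasurable (by fun_prop))
      (Eventually.of_forall fun x => (Complex.norm_exp_ofReal_mul_I _).le)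
  have h1 := hasSum_integral_measure hi
  rw [← compoundPoisson, ← charFun_apply] at h1
  have h2 := (NormedSpace.expSeries_div_hasSum_exp (charFun m ξ)).mul_left
      ((Real.exp (-m.real Set.univ) : ℝ) : ℂ)
  rw [← Complex.exp_eq_exp_ℂ, Complex.ofReal_exp, ← Complex.exp_add] at h2
  have e : ∫ z, (1 - Complex.exp (Complex.I * ((inner ℝ ξ z : ℝ) : ℂ))) ∂m
      = (m.real Set.univ : ℂ) - charFun m ξ := by
    have hi' : Integrable (fun z : E => Complex.exp (Complex.I * ((inner ℝ ξ z : ℝ) : ℂ))) m :=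
      (integrable_const (1 : ℝ)).mono' (Continuous.aestronglyMeasurable (by fun_prop))
        (Eventually.of_forall fun x => (norm_exp_I_mul_ofReal _).le)
    rw [integral_sub (integrable_const _) hi', charFun_apply]
    simp [real_inner_comm, mul_comm]
  rw [e, neg_sub, sub_eq_neg_add, ← Complex.ofReal_neg]
  refine h1.unique ?_
  rw [show (fun n : ℕ => ∫ x : E, Complex.exp ((inner ℝ x ξ : ℝ) * Complex.I)
      ∂ENNReal.ofReal (Real.exp (-m.real Set.univ) / n.factorial) • convPow m n) =
    fun n : ℕ => Complex.exp ((-m.real Set.univ : ℝ) : ℂ) * (charFun m ξ ^ n / n.factorial) from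
    funext fun n => by
      rw [integral_smul_measure, ← charFun_apply, charFun_convPow,
        ENNReal.toReal_ofReal (by positivity), Complex.real_smul, ← Complex.ofReal_exp]
      push_cast
      ring]
  exact h2

lemma abs_integral_le_of_abs_le {μ : Measure E} [IsFiniteMeasure μ] {u : E → ℝ} {M : ℝ}
    (hM : ∀ x, |u x| ≤ M) : |∫ x, u x ∂μ| ≤ M * μ.real Set.univ := by
  simpa using norm_integral_le_of_norm_le_const (μ := μ) (f := u) (C := M)
    (Eventually.of_forall hM)

-- `π` collects everything except the small jumps. It is convolved with measures of mass `O(‖h‖)`,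
-- so nothing but its total mass `1` matters. The law with exponent `compensatedExponent m` need not
-- be constructed: only its characteristic function enters.
open FourierTransform in
lemma exists_abs_integral_add_sub_integral_le (E : Type*) [NormedAddCommGroup E]
    [InnerProductSpace ℝ E] [FiniteDimensional ℝ E] [MeasurableSpace E] [BorelSpace E]
    (K W : ℝ) (hK : 0 ≤ K) (hW : 0 ≤ W) :
    ∃ C : ℝ, 0 < C ∧ ∀ m : Measure E, Integrable (fun z => ‖z‖ ^ 2) m → (∀ᵐ z ∂m, ‖z‖ ≤ 1) →
      ∫ z, ‖z‖ ^ 2 ∂m ≤ K →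
      Integrable (fun ξ : E => (1 + ‖ξ‖) ^ (Module.finrank ℝ E + 2) *
        Real.exp (-(compensatedExponent m ξ).re)) →
      ∫ ξ : E, (1 + ‖ξ‖) ^ (Module.finrank ℝ E + 2) *
        Real.exp (-(compensatedExponent m ξ).re) ≤ W →
      ∀ μ π : Measure E, IsProbabilityMeasure μ → IsProbabilityMeasure π →
      (∀ ξ, charFun μ ξ = Complex.exp (-compensatedExponent m ξ) * charFun π ξ) →
      ∀ h : E, ‖h‖ ≤ 1 → ∀ (u : E → ℝ) (M : ℝ), Measurable u → (∀ x, |u x| ≤ M) →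
        |∫ y, u (y + h) ∂μ - ∫ y, u y ∂μ| ≤ C * M * ‖h‖ := by
  obtain ⟨C, hC, H⟩ := exists_integral_norm_fourier_incrementSymbol_le E K W hK hW
  refine ⟨2 * C, by positivity, fun m hm hone hmK hint hintW μ π hμ hπ hch h hh u M hu hM => ?_⟩
  obtain ⟨hGi, hFi, hF⟩ := H m hm hone hmK hint hintW h hh
  obtain ⟨p, q, hp, hq, hpq, hpu, hqu⟩ := exists_charFun_sub_charFun_eq
    (contDiff_incrementSymbol hm hone h 0).continuous hGi hFi (conj_incrementSymbol m h)
  have hM0 : 0 ≤ M := (abs_nonneg _).trans (hM 0)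
  have hmap : IsProbabilityMeasure (μ.map (· + h)) :=
    Measure.isProbabilityMeasure_map (by fun_prop)
  have hui : ∀ (ρ : Measure E) [IsFiniteMeasure ρ], Integrable u ρ := fun ρ _ =>
    (integrable_const M).mono' hu.aestronglyMeasurable (Eventually.of_forall hM)
  -- The identity `τ_h μ - μ = (p - q) ∗ π`, rearranged so that both sides are positive measures and
  -- uniqueness of characteristic functions applies.
  have heq : μ.map (· + h) + q ∗ π = μ + p ∗ π := by
    refine Measure.ext_of_charFun (funext fun ξ => ?_)
    have hadd : ∀ (ρ σ : Measure E) [IsFiniteMeasure ρ] [IsFiniteMeasure σ],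
        charFun (ρ + σ) ξ = charFun ρ ξ + charFun σ ξ := by
      intro ρ σ _ _
      have hi : ∀ (τ : Measure E) [IsFiniteMeasure τ],
          Integrable (fun x : E => Complex.exp ((inner ℝ x ξ : ℝ) * Complex.I)) τ := fun τ _ =>
        (integrable_const (1 : ℝ)).mono' (Continuous.aestronglyMeasurable (by fun_prop))
          (Eventually.of_forall fun x => (Complex.norm_exp_ofReal_mul_I _).le)
      simp only [charFun_apply]
      exact integral_add_measure (hi ρ) (hi σ)
    rw [hadd, hadd, charFun_conv, charFun_conv, charFun_map_add_const, hch]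
    have h1 := hpq ξ
    unfold incrementSymbol at h1
    rw [real_inner_comm, mul_comm (Complex.I)] at h1
    linear_combination (-charFun π ξ) * h1
  have hint_eq : ∫ y, u (y + h) ∂μ + ∫ y, u y ∂(q ∗ π) = ∫ y, u y ∂μ + ∫ y, u y ∂(p ∗ π) := by
    rw [← integral_add_measure (hui μ) (hui _), ← heq, integral_add_measure (hui _) (hui _),
      integral_map (by fun_prop) hu.aestronglyMeasurable]
  have huniv : ∀ (ρ : Measure E) [IsFiniteMeasure ρ], (ρ ∗ π).real Set.univ = ρ.real Set.univ := by
    intro ρ _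
    have := charFun_conv (μ := ρ) (ν := π) 0
    simp only [charFun_zero, probReal_univ, Complex.ofReal_one, mul_one] at this
    exact_mod_cast this
  have hp' := abs_integral_le_of_abs_le (μ := p ∗ π) hM
  have hq' := abs_integral_le_of_abs_le (μ := q ∗ π) hM
  rw [huniv] at hp' hq'
  have e : ∫ y, u (y + h) ∂μ - ∫ y, u y ∂μ = ∫ y, u y ∂(p ∗ π) - ∫ y, u y ∂(q ∗ π) := by
    linarith
  rw [e]
  calc _ ≤ |∫ y, u y ∂(p ∗ π)| + |∫ y, u y ∂(q ∗ π)| := abs_sub _ _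
    _ ≤ M * (C * ‖h‖) + M * (C * ‖h‖) := by
        refine add_le_add (hp'.trans ?_) (hq'.trans ?_)
        · exact mul_le_mul_of_nonneg_left (hpu.trans hF) hM0
        · exact mul_le_mul_of_nonneg_left (hqu.trans hF) hM0
    _ = 2 * C * M * ‖h‖ := by ring

end Increments

/-! ### From a bound on `Re Φ` to a truncated second moment. -/

section Truncation

lemma min_one_sq_le_sub_sin_div {x : ℝ} (hx : 0 < x) :
    min 1 (x ^ 2) ≤ 40 * (1 - x⁻¹ * Real.sin x) := by
  rcases le_total x 2 with h2 | h2
  · have hb := Real.sin_bound (x := x / 2) (by rw [abs_of_pos (by linarith)]; linarith)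
    rw [abs_of_pos (by linarith : 0 < x / 2)] at hb
    have hb' := (abs_le.1 hb).2
    have hs : 0 ≤ Real.sin (x / 2) :=
      Real.sin_nonneg_of_nonneg_of_le_pi (by linarith) (by linarith [Real.pi_gt_three])
    have h1 : Real.sin x ≤ 2 * Real.sin (x / 2) := by
      have e : Real.sin x = 2 * Real.sin (x / 2) * Real.cos (x / 2) := by
        rw [← Real.sin_two_mul]; ring_nf
      rw [e]
      exact mul_le_of_le_one_right (by linarith) (Real.cos_le_one _)
    have h3 : Real.sin x ≤ x - x ^ 3 / 40 := by
      have h5 : 0 ≤ x ^ 3 * (4 - x ^ 2) := mul_nonneg (by positivity) (by nlinarith)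
      nlinarith [pow_pos hx 3]
    have h4 : x⁻¹ * Real.sin x ≤ 1 - x ^ 2 / 40 := by
      calc x⁻¹ * Real.sin x ≤ x⁻¹ * (x - x ^ 3 / 40) := by gcongr
        _ = _ := by field_simp
    exact (min_le_right _ _).trans (by linarith)
  · have h1 : x⁻¹ * Real.sin x ≤ 2⁻¹ * 1 :=
      calc x⁻¹ * Real.sin x ≤ x⁻¹ * 1 := by gcongr; exact Real.sin_le_one x
        _ ≤ _ := by gcongr
    exact (min_le_left _ _).trans (by linarith)

/-- Averaging over `s` removes the zeros of `1 - cos` at nonzero multiples of `2π`: the mean is `1 -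
sin x / x`, which is of order `x²` near `0` and stays away from `0` elsewhere. -/
lemma min_one_sq_le_integral (x : ℝ) :
    min 1 (x ^ 2) ≤ 40 * ∫ s in (0 : ℝ)..1, (1 - Real.cos (s * x)) := by
  wlog hx : 0 ≤ x with H
  · simpa using H (-x) (by linarith)
  rcases hx.eq_or_lt with rfl | hx
  · simp
  have e : ∫ s in (0 : ℝ)..1, (1 - Real.cos (s * x)) = 1 - x⁻¹ * Real.sin x := by
    rw [intervalIntegral.integral_sub (by simp) (Continuous.intervalIntegrable (by fun_prop) _ _),
      intervalIntegral.integral_comp_mul_right _ hx.ne']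
    simp
  rw [e]
  exact min_one_sq_le_sub_sin_div hx

lemma ofReal_min_one_sq_le_lintegral (x : ℝ) :
    ENNReal.ofReal (min 1 (x ^ 2)) ≤
      40 * ∫⁻ s in Set.Ioc (0 : ℝ) 1, ENNReal.ofReal (1 - Real.cos (s * x)) := by
  have hi : IntegrableOn (fun s : ℝ => 1 - Real.cos (s * x)) (Set.Ioc 0 1) :=
    (Continuous.integrableOn_Icc (by fun_prop)).mono_set Set.Ioc_subset_Icc_self
  rw [← ofReal_integral_eq_lintegral_ofReal hi
    (Eventually.of_forall fun s => sub_nonneg.2 (Real.cos_le_one _)),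
    ← intervalIntegral.integral_of_le zero_le_one,
    show (40 : ℝ≥0∞) = ENNReal.ofReal 40 by simp, ← ENNReal.ofReal_mul (by norm_num)]
  exact ENNReal.ofReal_le_ofReal (min_one_sq_le_integral x)

variable {d : ℕ}

lemma min_one_norm_sq_le_sum (z : EuclideanSpace ℝ (Fin d)) :
    min 1 (‖z‖ ^ 2) ≤ ∑ i, min 1 (z i ^ 2) := by
  have hnn : ∀ i, 0 ≤ min 1 (z i ^ 2) := fun i => by positivity
  by_cases h : ∃ i, 1 ≤ z i ^ 2
  · obtain ⟨i, hi⟩ := h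
    calc min 1 (‖z‖ ^ 2) ≤ 1 := min_le_left _ _
      _ = min 1 (z i ^ 2) := (min_eq_left hi).symm
      _ ≤ _ := Finset.single_le_sum (f := fun i => min 1 (z i ^ 2)) (fun i _ => hnn i)
        (Finset.mem_univ i)
  · push Not at h
    refine (min_le_right _ _).trans (le_of_eq ?_)
    rw [EuclideanSpace.real_norm_sq_eq]
    exact Finset.sum_congr rfl fun i _ => (min_eq_right (h i).le).symm

/-- A bound on `Re Φ` over the unit ball controls the truncated second moment of the
Lévy measure. -/
lemma lintegral_min_one_norm_sq_le {ν : Measure (EuclideanSpace ℝ (Fin d))} [SFinite ν]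
    (h : ∀ η : EuclideanSpace ℝ (Fin d), ‖η‖ ≤ 1 →
      ∫⁻ z, ENNReal.ofReal (1 - Real.cos (inner ℝ η z)) ∂ν ≤ 1) :
    ∫⁻ z, ENNReal.ofReal (min 1 (‖z‖ ^ 2)) ∂ν ≤ ENNReal.ofReal (40 * d) := by
  have hcoord : ∀ i : Fin d, ∫⁻ z, ENNReal.ofReal (min 1 (z i ^ 2)) ∂ν ≤ 40 := by
    intro i
    calc ∫⁻ z, ENNReal.ofReal (min 1 (z i ^ 2)) ∂ν
        ≤ ∫⁻ z, (40 * ∫⁻ s in Set.Ioc (0 : ℝ) 1, ENNReal.ofReal (1 - Real.cos (s * z i))) ∂ν :=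
          lintegral_mono fun z => ofReal_min_one_sq_le_lintegral _
      _ = 40 * ∫⁻ z, (∫⁻ s in Set.Ioc (0 : ℝ) 1, ENNReal.ofReal (1 - Real.cos (s * z i))) ∂ν :=
          lintegral_const_mul' _ _ (by simp)
      _ = 40 * ∫⁻ s in Set.Ioc (0 : ℝ) 1, ∫⁻ z, ENNReal.ofReal (1 - Real.cos (s * z i)) ∂ν := by
          rw [lintegral_lintegral_swap]
          exact Measurable.aemeasurable (by fun_prop)
      _ ≤ 40 * ∫⁻ s in Set.Ioc (0 : ℝ) 1, 1 := by
          gcongr 40 * ?_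
          refine setLIntegral_mono measurable_const fun s hs => ?_
          -- The test vector `s eᵢ` has norm `s ≤ 1` and sees only the coordinate `z i`.
          have := h (EuclideanSpace.single i s) (by
            rw [PiLp.norm_single, Real.norm_of_nonneg hs.1.le]; exact hs.2)
          simpa [EuclideanSpace.inner_single_left, mul_comm] using this
      _ = 40 := by simp
  calc ∫⁻ z, ENNReal.ofReal (min 1 (‖z‖ ^ 2)) ∂ν
      ≤ ∫⁻ z, ∑ i, ENNReal.ofReal (min 1 (z i ^ 2)) ∂ν := by
        refine lintegral_mono fun z => ?_
        rw [← ENNReal.ofReal_sum_of_nonneg fun i _ => by positivity]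
        exact ENNReal.ofReal_le_ofReal (min_one_norm_sq_le_sum z)
    _ = ∑ i, ∫⁻ z, ENNReal.ofReal (min 1 (z i ^ 2)) ∂ν :=
        lintegral_finsetSum _ fun i _ => by fun_prop
    _ ≤ ∑ _i : Fin d, 40 := Finset.sum_le_sum fun i _ => hcoord i
    _ = ENNReal.ofReal (40 * d) := by
        rw [ENNReal.ofReal_mul (by norm_num), ENNReal.ofReal_natCast]
        simp [mul_comm]

/-- The density `min 1 ‖z‖²` turns `ν` into a finite measure and is positive off the origin, which
`ν` does not charge, so it can be inverted. The Tonelli step in `lintegral_min_one_norm_sq_le` needs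
this. -/
lemma IsLevyMeasure.sFinite {ν : Measure (EuclideanSpace ℝ (Fin d))} (hν : IsLevyMeasure ν) :
    SFinite ν := by
  set f : EuclideanSpace ℝ (Fin d) → ℝ≥0∞ := fun z => ENNReal.ofReal (min 1 (‖z‖ ^ 2))
  have hf : Measurable f := by fun_prop
  have hfin : IsFiniteMeasure (ν.withDensity f) := isFiniteMeasure_withDensity hν.lintegral_lt_top.ne
  have hne : ∀ᵐ z ∂ν, z ≠ 0 := by
    rw [ae_iff]; simpa using hν.zero_singleton
  have e := withDensity_inv_same hf (μ := ν) (by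
    filter_upwards [hne] with z hz
    have : 0 < min 1 (‖z‖ ^ 2) := lt_min one_pos (by positivity)
    exact (ENNReal.ofReal_pos.2 this).ne') (Eventually.of_forall fun z => ENNReal.ofReal_ne_top)
  rw [← e]
  infer_instance

lemma IsLevyMeasure.symbol_eq {ν : Measure (EuclideanSpace ℝ (Fin d))} (hν : IsLevyMeasure ν)
    (ξ : EuclideanSpace ℝ (Fin d)) : symbol ν ξ = ∫ z, symbolIntegrand ξ z ∂ν := by
  have hne : ∀ᵐ z ∂ν, z ∈ ({0}ᶜ : Set (EuclideanSpace ℝ (Fin d))) := by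
    rw [ae_iff]; simpa using hν.zero_singleton
  rw [symbol, Measure.restrict_eq_self_of_ae_mem hne]

lemma IsLevyMeasure.integrable_min {ν : Measure (EuclideanSpace ℝ (Fin d))}
    (hν : IsLevyMeasure ν) : Integrable (fun z => min 1 (‖z‖ ^ 2)) ν := by
  refine ⟨by fun_prop, ?_⟩
  rw [hasFiniteIntegral_iff_ofReal (Eventually.of_forall fun z => by positivity)]
  exact hν.lintegral_lt_top

lemma IsLevyMeasure.integrable_symbolIntegrand {ν : Measure (EuclideanSpace ℝ (Fin d))}
    (hν : IsLevyMeasure ν) (ξ : EuclideanSpace ℝ (Fin d)) : Integrable (symbolIntegrand ξ) ν :=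
  (hν.integrable_min.const_mul (3 * ‖ξ‖ ^ 2 + 2)).mono'
    (measurable_symbolIntegrand ξ).aestronglyMeasurable
    (Eventually.of_forall fun z => norm_symbolIntegrand_le ξ z)

lemma re_symbolIntegrand (ξ z : EuclideanSpace ℝ (Fin d)) :
    (symbolIntegrand ξ z).re = 1 - Real.cos (inner ℝ ξ z) := by
  unfold symbolIntegrand
  rw [mul_comm Complex.I, Complex.add_re, Complex.sub_re, Complex.exp_ofReal_mul_I_re]
  by_cases hz : z ∈ Metric.ball (0 : EuclideanSpace ℝ (Fin d)) 1
  · rw [Set.indicator_of_mem hz]; simp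
  · rw [Set.indicator_of_notMem hz]; simp

lemma IsLevyMeasure.ofReal_re_symbol {ν : Measure (EuclideanSpace ℝ (Fin d))}
    (hν : IsLevyMeasure ν) (ξ : EuclideanSpace ℝ (Fin d)) :
    ENNReal.ofReal (symbol ν ξ).re =
      ∫⁻ z, ENNReal.ofReal (1 - Real.cos (inner ℝ ξ z)) ∂ν := by
  have h : (symbol ν ξ).re = ∫ z, (1 - Real.cos (inner ℝ ξ z)) ∂ν := by
    rw [hν.symbol_eq]
    simp_rw [← re_symbolIntegrand]
    exact (integral_re (hν.integrable_symbolIntegrand ξ)).symm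
  have hi : Integrable (fun z => 1 - Real.cos (inner ℝ ξ z)) ν := by
    simp_rw [← re_symbolIntegrand]
    exact (hν.integrable_symbolIntegrand ξ).re
  rw [h, ofReal_integral_eq_lintegral_ofReal hi
    (Eventually.of_forall fun z => sub_nonneg.2 (Real.cos_le_one _))]

lemma IsLevyMeasure.re_symbol_le_supRe {ν : Measure (EuclideanSpace ℝ (Fin d))}
    (hν : IsLevyMeasure ν) {R : ℝ} {η : EuclideanSpace ℝ (Fin d)} (hη : ‖η‖ ≤ R) :
    (symbol ν η).re ≤ supRe (symbol ν) R := by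
  have hc : Continuous fun η => (symbol ν η).re :=
    Complex.continuous_re.comp (continuous_symbol hν)
  exact le_csSup ((isCompact_closedBall _ _).image hc).bddAbove ⟨η, by simpa using hη, rfl⟩

end Truncation

/-! ### Splitting and rescaling the jump measure. -/

section Scaling

variable {d : ℕ}

local notation "𝔼" => EuclideanSpace ℝ (Fin d)

/-- The restriction of a measure to the unit ball: the small jumps. -/
noncomputable def smallJumps (ν : Measure 𝔼) : Measure 𝔼 := ν.restrict (Metric.ball 0 1)

/-- The restriction of a measure to the complement of the unit ball: the large jumps. -/
noncomputable def largeJumps (ν : Measure 𝔼) : Measure 𝔼 := ν.restrict (Metric.ball 0 1)ᶜ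

lemma norm_le_one_ae_smallJumps (ν : Measure 𝔼) : ∀ᵐ z ∂smallJumps ν, ‖z‖ ≤ 1 := by
  filter_upwards [ae_restrict_mem Metric.isOpen_ball.measurableSet] with z hz
  simpa using (mem_ball_zero_iff.1 hz).le

lemma lintegral_norm_sq_smallJumps_le (ν : Measure 𝔼) :
    ∫⁻ z, ENNReal.ofReal (‖z‖ ^ 2) ∂smallJumps ν ≤
      ∫⁻ z, ENNReal.ofReal (min 1 (‖z‖ ^ 2)) ∂ν := by
  refine le_trans (lintegral_mono_ae ?_) (setLIntegral_le_lintegral (Metric.ball 0 1) _)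
  filter_upwards [norm_le_one_ae_smallJumps ν] with z hz
  rw [min_eq_right (pow_le_one₀ (norm_nonneg z) hz)]

lemma largeJumps_univ_le (ν : Measure 𝔼) :
    largeJumps ν Set.univ ≤ ∫⁻ z, ENNReal.ofReal (min 1 (‖z‖ ^ 2)) ∂ν := by
  rw [← lintegral_one]
  refine le_trans (lintegral_mono_ae ?_) (setLIntegral_le_lintegral (Metric.ball 0 1)ᶜ _)
  filter_upwards [ae_restrict_mem Metric.isOpen_ball.measurableSet.compl] with z hz
  have h1 : 1 ≤ ‖z‖ := by simpa using hz
  rw [min_eq_left (one_le_pow₀ h1), ENNReal.ofReal_one]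

lemma integrable_norm_sq_smallJumps {ν : Measure 𝔼} {K : ℝ}
    (h : ∫⁻ z, ENNReal.ofReal (min 1 (‖z‖ ^ 2)) ∂ν ≤ ENNReal.ofReal K) :
    Integrable (fun z => ‖z‖ ^ 2) (smallJumps ν) := by
  refine ⟨by fun_prop, ?_⟩
  rw [hasFiniteIntegral_iff_ofReal (Eventually.of_forall fun z => by positivity)]
  exact ((lintegral_norm_sq_smallJumps_le ν).trans h).trans_lt ENNReal.ofReal_lt_top

lemma integral_norm_sq_smallJumps_le {ν : Measure 𝔼} {K : ℝ} (hK : 0 ≤ K)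
    (h : ∫⁻ z, ENNReal.ofReal (min 1 (‖z‖ ^ 2)) ∂ν ≤ ENNReal.ofReal K) :
    ∫ z, ‖z‖ ^ 2 ∂smallJumps ν ≤ K := by
  rw [integral_eq_lintegral_of_nonneg_ae (Eventually.of_forall fun z => by positivity)
    (by fun_prop)]
  exact ENNReal.toReal_le_of_le_ofReal hK ((lintegral_norm_sq_smallJumps_le ν).trans h)

lemma isFiniteMeasure_largeJumps {ν : Measure 𝔼} {K : ℝ}
    (h : ∫⁻ z, ENNReal.ofReal (min 1 (‖z‖ ^ 2)) ∂ν ≤ ENNReal.ofReal K) :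
    IsFiniteMeasure (largeJumps ν) :=
  ⟨((largeJumps_univ_le ν).trans h).trans_lt ENNReal.ofReal_lt_top⟩

/-- For an exponent compensated on the ball of radius `R`, splitting into small and
large jumps at radius `1` changes the exponent by a drift only. -/
lemma exists_integral_eq_compensatedExponent_add {ν : Measure 𝔼} {K R : ℝ} (hR : 0 < R)
    (h : ∫⁻ z, ENNReal.ofReal (min 1 (‖z‖ ^ 2)) ∂ν ≤ ENNReal.ofReal K) :
    ∃ b : 𝔼, ∀ η : 𝔼,
      ∫ z, (1 - Complex.exp (Complex.I * ((inner ℝ η z : ℝ) : ℂ))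
        + Complex.I * ((inner ℝ η z : ℝ) : ℂ)
          * (Metric.ball (0 : 𝔼) R).indicator (fun _ => (1 : ℂ)) z) ∂ν =
      compensatedExponent (smallJumps ν) η
        + ∫ z, (1 - Complex.exp (Complex.I * ((inner ℝ η z : ℝ) : ℂ))) ∂largeJumps ν
        + Complex.I * ((inner ℝ η b : ℝ) : ℂ) := by
  have hfin := isFiniteMeasure_largeJumps h
  have hsm := integrable_norm_sq_smallJumps h
  have hball : MeasurableSet (Metric.ball (0 : 𝔼) R) := Metric.isOpen_ball.measurableSet
  -- For `‖z‖ ≥ R` one has `‖z‖ ≤ R⁻¹ ‖z‖²`, so the second moment suffices.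
  have hws : Integrable (fun z : 𝔼 => (Metric.ball (0 : 𝔼) R)ᶜ.indicator id z) (smallJumps ν) := by
    refine (hsm.const_mul R⁻¹).mono' (measurable_id.indicator hball.compl).aestronglyMeasurable
      (Eventually.of_forall fun z => ?_)
    by_cases hz : z ∈ (Metric.ball (0 : 𝔼) R)ᶜ
    · rw [Set.indicator_of_mem hz, id]
      have h1 : R ≤ ‖z‖ := by simpa using hz
      rw [← div_eq_inv_mul, le_div_iff₀ hR]
      nlinarith [norm_nonneg z]
    · rw [Set.indicator_of_notMem hz, norm_zero]
      positivity
  have hwl : Integrable (fun z : 𝔼 => (Metric.ball (0 : 𝔼) R).indicator id z) (largeJumps ν) := by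
    refine (integrable_const R).mono' (measurable_id.indicator hball).aestronglyMeasurable
      (Eventually.of_forall fun z => ?_)
    by_cases hz : z ∈ Metric.ball (0 : 𝔼) R
    · rw [Set.indicator_of_mem hz, id]
      exact (mem_ball_zero_iff.1 hz).le
    · rw [Set.indicator_of_notMem hz, norm_zero]
      exact hR.le
  -- The drift corrects the compensation between the radii `R` and `1`: the first integral is the
  -- correction when `R < 1`, the second when `R > 1`.
  refine ⟨-(∫ z, (Metric.ball (0 : 𝔼) R)ᶜ.indicator id z ∂smallJumps ν)
    + ∫ z, (Metric.ball (0 : 𝔼) R).indicator id z ∂largeJumps ν, fun η => ?_⟩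
  have hlin : ∀ (ρ : Measure 𝔼) (w : 𝔼 → 𝔼), Integrable w ρ →
      Integrable (fun z => Complex.I * ((inner ℝ η (w z) : ℝ) : ℂ)) ρ ∧
      ∫ z, Complex.I * ((inner ℝ η (w z) : ℝ) : ℂ) ∂ρ
        = Complex.I * ((inner ℝ η (∫ z, w z ∂ρ) : ℝ) : ℂ) := by
    intro ρ w hw
    refine ⟨(hw.const_inner η).ofReal.const_mul _, ?_⟩
    rw [integral_const_mul, integral_complex_ofReal, integral_inner hw]
  have hexp : Integrable (fun z => 1 - Complex.exp (Complex.I * ((inner ℝ η z : ℝ) : ℂ)))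
      (largeJumps ν) := by
    refine (integrable_const (2 : ℝ)).mono' (Continuous.aestronglyMeasurable (by fun_prop))
      (Eventually.of_forall fun z => (norm_sub_le _ _).trans ?_)
    rw [norm_exp_I_mul_ofReal, norm_one]
    norm_num
  have es : ∀ z : 𝔼, 1 - Complex.exp (Complex.I * ((inner ℝ η z : ℝ) : ℂ))
        + Complex.I * ((inner ℝ η z : ℝ) : ℂ)
          * (Metric.ball (0 : 𝔼) R).indicator (fun _ => (1 : ℂ)) z =
      (1 - Complex.exp (Complex.I * ((inner ℝ η z : ℝ) : ℂ))
        + Complex.I * ((inner ℝ η z : ℝ) : ℂ)) -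
        Complex.I * ((inner ℝ η ((Metric.ball (0 : 𝔼) R)ᶜ.indicator id z) : ℝ) : ℂ) := by
    intro z
    by_cases hz : z ∈ Metric.ball (0 : 𝔼) R
    · rw [Set.indicator_of_mem hz, Set.indicator_of_notMem (by simpa using hz)]
      simp
    · rw [Set.indicator_of_notMem hz, Set.indicator_of_mem (by simpa using hz)]
      simp
  have el : ∀ z : 𝔼, 1 - Complex.exp (Complex.I * ((inner ℝ η z : ℝ) : ℂ))
        + Complex.I * ((inner ℝ η z : ℝ) : ℂ)
          * (Metric.ball (0 : 𝔼) R).indicator (fun _ => (1 : ℂ)) z =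
      (1 - Complex.exp (Complex.I * ((inner ℝ η z : ℝ) : ℂ))) +
        Complex.I * ((inner ℝ η ((Metric.ball (0 : 𝔼) R).indicator id z) : ℝ) : ℂ) := by
    intro z
    by_cases hz : z ∈ Metric.ball (0 : 𝔼) R
    · rw [Set.indicator_of_mem hz, Set.indicator_of_mem hz]
      simp
    · rw [Set.indicator_of_notMem hz, Set.indicator_of_notMem hz]
      simp
  obtain ⟨hsi, hse⟩ := hlin (smallJumps ν) _ hws
  obtain ⟨hli, hle⟩ := hlin (largeJumps ν) _ hwl
  have hcomp := integrable_compensated_exp hsm η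
  rw [← integral_add_compl₀ (μ := ν) (s := Metric.ball (0 : 𝔼) 1)
    Metric.isOpen_ball.measurableSet.nullMeasurableSet]
  · change ∫ z, _ ∂smallJumps ν + ∫ z, _ ∂largeJumps ν = _
    rw [integral_congr_ae (μ := smallJumps ν) (Eventually.of_forall es),
      integral_congr_ae (μ := largeJumps ν) (Eventually.of_forall el),
      integral_sub hcomp hsi, integral_add hexp hli, hse, hle, inner_add_right, inner_neg_right]
    unfold compensatedExponent
    push_cast
    ring
  · rw [← Measure.restrict_univ (μ := ν), ← Set.union_compl_self (Metric.ball (0 : 𝔼) 1)]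
    refine IntegrableOn.union ?_ ?_
    · exact (hcomp.sub hsi).congr (Eventually.of_forall fun z => (es z).symm)
    · exact (hexp.add hli).congr (Eventually.of_forall fun z => (el z).symm)

/-- The Lévy measure of `R • X_t` for a Lévy process `X` with Lévy measure `ν`. -/
noncomputable def scaledJumps (ν : Measure 𝔼) (t : ℝ≥0) (R : ℝ) : Measure 𝔼 :=
  t • ν.map (fun z => R • z)

/-- For `‖η‖ ≤ 1` the rescaled real part is `t Re Φ(Rη) ≤ t φ(R) = 1`. This is the only use of the
relation between `R` and `t`. -/
lemma IsLevyMeasure.lintegral_scaledJumps_le {ν : Measure 𝔼} (hν : IsLevyMeasure ν) {t : ℝ≥0}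
    (ht : 0 < t) {R : ℝ} (hR : 0 < R) (hφ : supRe (symbol ν) R = 1 / t) :
    ∫⁻ z, ENNReal.ofReal (min 1 (‖z‖ ^ 2)) ∂scaledJumps ν t R ≤ ENNReal.ofReal (40 * d) := by
  have := hν.sFinite
  have : SFinite (scaledJumps ν t R) := by unfold scaledJumps; infer_instance
  refine lintegral_min_one_norm_sq_le fun η hη => ?_
  have hR' : Measurable fun z : 𝔼 => R • z := by fun_prop
  rw [scaledJumps, lintegral_smul_measure, lintegral_map (by fun_prop) hR']
  have e : ∫⁻ z, ENNReal.ofReal (1 - Real.cos (inner ℝ η (R • z))) ∂ν =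
      ENNReal.ofReal (symbol ν (R • η)).re := by
    rw [hν.ofReal_re_symbol]
    simp only [inner_smul_left, inner_smul_right, RCLike.conj_to_real]
  have hle : (symbol ν (R • η)).re ≤ 1 / t := hφ ▸ hν.re_symbol_le_supRe (by
    rw [norm_smul, Real.norm_of_nonneg hR.le]; exact mul_le_of_le_one_right hR.le hη)
  rw [e, ENNReal.smul_def, smul_eq_mul]
  calc (t : ℝ≥0∞) * ENNReal.ofReal (symbol ν (R • η)).re ≤ t * ENNReal.ofReal (1 / t) := by
        gcongr
    _ = 1 := by
      rw [← ENNReal.ofReal_coe_nnreal, ← ENNReal.ofReal_mul t.coe_nonneg,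
        mul_one_div_cancel (by exact_mod_cast ht.ne'), ENNReal.ofReal_one]

/-- Dilation by `R` carries the unit ball to the ball of radius `R`, so the rescaled exponent is
compensated there. -/
lemma IsLevyMeasure.smul_symbol_eq {ν : Measure 𝔼} (hν : IsLevyMeasure ν) (t : ℝ≥0)
    {R : ℝ} (hR : 0 < R) (η : 𝔼) :
    ((t : ℝ) : ℂ) * symbol ν (R • η) =
      ∫ z, (1 - Complex.exp (Complex.I * ((inner ℝ η z : ℝ) : ℂ))
        + Complex.I * ((inner ℝ η z : ℝ) : ℂ)
          * (Metric.ball (0 : 𝔼) R).indicator (fun _ => (1 : ℂ)) z) ∂scaledJumps ν t R := by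
  have hR' : Measurable fun z : 𝔼 => R • z := by fun_prop
  have hind : Measurable ((Metric.ball (0 : 𝔼) R).indicator (fun _ => (1 : ℂ))) :=
    measurable_const.indicator Metric.isOpen_ball.measurableSet
  rw [scaledJumps, integral_smul_nnreal_measure, integral_map hR'.aemeasurable
    (Measurable.aestronglyMeasurable (by fun_prop)), hν.symbol_eq, NNReal.smul_def,
    Complex.real_smul]
  congr 1
  refine integral_congr_ae (Eventually.of_forall fun z => ?_)
  have hmem : (Metric.ball (0 : 𝔼) R).indicator (fun _ => (1 : ℂ)) (R • z) =
      (Metric.ball (0 : 𝔼) 1).indicator (fun _ => (1 : ℂ)) z := by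
    have hiff : R • z ∈ Metric.ball (0 : 𝔼) R ↔ z ∈ Metric.ball (0 : 𝔼) 1 := by
      rw [mem_ball_zero_iff, mem_ball_zero_iff, norm_smul, Real.norm_of_nonneg hR.le]
      exact mul_lt_iff_lt_one_right hR
    by_cases hz : z ∈ Metric.ball (0 : 𝔼) 1
    · rw [Set.indicator_of_mem hz, Set.indicator_of_mem (hiff.2 hz)]
    · rw [Set.indicator_of_notMem hz, Set.indicator_of_notMem (fun h => hz (hiff.1 h))]
  simp only [symbolIntegrand, hmem, inner_smul_left, inner_smul_right, RCLike.conj_to_real]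

lemma lintegral_smul_comp_eq {R : ℝ} (hR : 0 < R) {f : 𝔼 → ℝ≥0∞} (hf : Measurable f) :
    ∫⁻ η, f (R • η) = ENNReal.ofReal ((R ^ d)⁻¹) * ∫⁻ η, f η := by
  have hR' : Measurable fun z : 𝔼 => R • z := by fun_prop
  rw [← lintegral_map hf hR', Measure.map_addHaar_smul _ hR.ne', lintegral_smul_measure,
    finrank_euclideanSpace_fin, abs_of_pos (by positivity), smul_eq_mul]

/-- The power in `(*)` is exactly scale invariant: `2d + 2` is `d` from the Jacobian plus `d + 2`
from the weight. -/
lemma lintegral_exp_scaled_le {ν : Measure 𝔼} (hν : IsLevyMeasure ν) {t : ℝ≥0} {R c₀ : ℝ}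
    (hR : 0 < R) (hmom : momentIntegral (symbol ν) t ≤ ENNReal.ofReal (c₀ * R ^ (2 * d + 2))) :
    ∫⁻ η : 𝔼, ENNReal.ofReal (Real.exp (-(t * (symbol ν (R • η)).re)) * ‖η‖ ^ (d + 2))
      ≤ ENNReal.ofReal c₀ := by
  have hc : Continuous fun η => (symbol ν η).re :=
    Complex.continuous_re.comp (continuous_symbol hν)
  have e : ∀ η : 𝔼, ENNReal.ofReal (Real.exp (-(t * (symbol ν (R • η)).re)) * ‖η‖ ^ (d + 2)) =
      ENNReal.ofReal ((R ^ (d + 2))⁻¹) *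
        ENNReal.ofReal (Real.exp (-(t * (symbol ν (R • η)).re)) * ‖R • η‖ ^ (d + 2)) := by
    intro η
    rw [← ENNReal.ofReal_mul (by positivity), norm_smul, Real.norm_of_nonneg hR.le]
    congr 1
    field_simp
    ring
  simp_rw [e]
  rw [lintegral_const_mul' _ _ ENNReal.ofReal_ne_top, lintegral_smul_comp_eq hR
    (f := fun η => ENNReal.ofReal (Real.exp (-(t * (symbol ν η).re)) * ‖η‖ ^ (d + 2)))
    (by have := hc.measurable; fun_prop)]
  calc _ ≤ ENNReal.ofReal ((R ^ (d + 2))⁻¹) * (ENNReal.ofReal ((R ^ d)⁻¹) *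
        ENNReal.ofReal (c₀ * R ^ (2 * d + 2))) := by
        gcongr
        exact hmom
    _ = ENNReal.ofReal c₀ := by
        rw [← ENNReal.ofReal_mul (by positivity), ← ENNReal.ofReal_mul (by positivity)]
        congr 1
        field_simp
        ring

end Scaling

/-! ### The Lipschitz estimate for the semigroup and the gradient bound. -/

section Gradient

variable {d : ℕ}

local notation "𝔼" => EuclideanSpace ℝ (Fin d)

lemma re_compensatedExponent_nonneg {m : Measure 𝔼} (hm : Integrable (fun z => ‖z‖ ^ 2) m)
    (η : 𝔼) : 0 ≤ (compensatedExponent m η).re := by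
  have e : (compensatedExponent m η).re = ∫ z, (1 - Complex.exp (Complex.I * ((inner ℝ η z : ℝ) : ℂ))
      + Complex.I * ((inner ℝ η z : ℝ) : ℂ)).re ∂m :=
    (integral_re (integrable_compensated_exp hm η)).symm
  rw [e]
  refine integral_nonneg fun z => ?_
  simp only [mul_comm Complex.I, Complex.add_re, Complex.sub_re, Complex.exp_ofReal_mul_I_re,
    Complex.one_re, Complex.mul_I_re, Complex.ofReal_im, Pi.zero_apply]
  linarith [Real.cos_le_one (inner ℝ η z)]

/-- Weighted integrability of `exp (-Re Ψ)` follows from integrability of `|η|^{d+2} exp (-g)`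
where `g ≤ Re Ψ + L`. -/
lemma integrable_and_integral_le_of_lintegral_le {m : Measure 𝔼} {g : 𝔼 → ℝ} {L c₀ : ℝ}
    (hm : Integrable (fun z => ‖z‖ ^ 2) m) (hone : ∀ᵐ z ∂m, ‖z‖ ≤ 1) (hg : Continuous g)
    (hc₀ : 0 ≤ c₀) (hL : ∀ η, g η ≤ (compensatedExponent m η).re + L)
    (hint : ∫⁻ η : 𝔼, ENNReal.ofReal (Real.exp (-g η) * ‖η‖ ^ (d + 2)) ≤ ENNReal.ofReal c₀) :
    Integrable (fun η : 𝔼 => (1 + ‖η‖) ^ (Module.finrank ℝ 𝔼 + 2) *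
        Real.exp (-(compensatedExponent m η).re)) ∧
    ∫ η : 𝔼, (1 + ‖η‖) ^ (Module.finrank ℝ 𝔼 + 2) *
        Real.exp (-(compensatedExponent m η).re) ≤
      2 ^ (d + 2) * (volume.real (Metric.closedBall (0 : 𝔼) 1) + Real.exp L * c₀) := by
  rw [finrank_euclideanSpace_fin]
  have hgi : Integrable (fun η : 𝔼 => Real.exp (-g η) * ‖η‖ ^ (d + 2)) := by
    refine ⟨Continuous.aestronglyMeasurable (by fun_prop), ?_⟩
    rw [hasFiniteIntegral_iff_ofReal (Eventually.of_forall fun z => by positivity)]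
    exact hint.trans_lt ENNReal.ofReal_lt_top
  have hgb : ∫ η : 𝔼, Real.exp (-g η) * ‖η‖ ^ (d + 2) ≤ c₀ := by
    rw [integral_eq_lintegral_of_nonneg_ae (Eventually.of_forall fun z => by positivity) hgi.1]
    exact ENNReal.toReal_le_of_le_ofReal hc₀ hint
  have hind : Integrable ((Metric.closedBall (0 : 𝔼) 1).indicator fun _ => (1 : ℝ)) :=
    (integrable_indicator_iff Metric.isClosed_closedBall.measurableSet).2
      (integrableOn_const measure_closedBall_lt_top.ne)
  have hbi := (hind.add (hgi.const_mul (Real.exp L))).const_mul (2 ^ (d + 2))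
  have hpt : ∀ η : 𝔼, (1 + ‖η‖) ^ (d + 2) * Real.exp (-(compensatedExponent m η).re) ≤
      2 ^ (d + 2) * ((Metric.closedBall (0 : 𝔼) 1).indicator (fun _ => (1 : ℝ)) η +
        Real.exp L * (Real.exp (-g η) * ‖η‖ ^ (d + 2))) := by
    intro η
    -- The weight `‖η‖^(d+2)` gives no control near the origin, where `Re Ψ ≥ 0` is used instead;
    -- outside the unit ball `1 + ‖η‖ ≤ 2 ‖η‖`.
    by_cases hη : η ∈ Metric.closedBall (0 : 𝔼) 1
    · have h1 : ‖η‖ ≤ 1 := by simpa using hη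
      rw [Set.indicator_of_mem hη]
      have h2 : Real.exp (-(compensatedExponent m η).re) ≤ 1 :=
        Real.exp_le_one_iff.2 (neg_nonpos.2 (re_compensatedExponent_nonneg hm η))
      calc _ ≤ (2 : ℝ) ^ (d + 2) * 1 := by
            gcongr
            linarith
        _ ≤ _ := by
            gcongr
            exact le_add_of_nonneg_right (by positivity)
    · have h1 : 1 ≤ ‖η‖ := by simpa using (lt_of_not_ge (by simpa using hη)).le
      rw [Set.indicator_of_notMem hη, zero_add]
      have h2 : Real.exp (-(compensatedExponent m η).re) ≤ Real.exp L * Real.exp (-g η) := by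
        rw [← Real.exp_add, Real.exp_le_exp]
        linarith [hL η]
      calc _ ≤ (2 * ‖η‖) ^ (d + 2) * (Real.exp L * Real.exp (-g η)) := by
            gcongr
            linarith
        _ = _ := by rw [mul_pow]; ring
  have hi : Integrable (fun η : 𝔼 =>
      (1 + ‖η‖) ^ (d + 2) * Real.exp (-(compensatedExponent m η).re)) := by
    have hcont := (contDiff_compensatedExponent hm hone 0).continuous
    refine hbi.mono' (Continuous.aestronglyMeasurable ?_) (Eventually.of_forall fun η => ?_)
    · exact ((continuous_const.add continuous_norm).pow _).mul
        (Complex.continuous_re.comp hcont).neg.rexp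
    · rw [Real.norm_of_nonneg (by positivity)]
      exact hpt η
  refine ⟨hi, (integral_mono hi hbi hpt).trans ?_⟩
  simp only [Pi.add_apply]
  rw [integral_const_mul, integral_add hind (hgi.const_mul _), integral_const_mul,
    integral_indicator Metric.isClosed_closedBall.measurableSet, setIntegral_const, smul_eq_mul,
    mul_one]
  gcongr

/-- The local Lipschitz estimate for the semigroup at spatial scale `1 / R`, where
`φ R = 1 / t`. -/
lemma exists_semigroup_sub_le (d : ℕ) {c₀ : ℝ} (hc₀ : 0 < c₀) :
    ∃ C : ℝ, 0 < C ∧ ∀ {Ω : Type*} [MeasurableSpace Ω] (P : Measure Ω)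
      [IsProbabilityMeasure P] (X : ℝ≥0 → Ω → EuclideanSpace ℝ (Fin d))
      (ν : Measure (EuclideanSpace ℝ (Fin d))), IsPureJumpLevyProcess P X ν →
      ∀ (t : ℝ≥0) (R : ℝ), 0 < t → 0 < R → supRe (symbol ν) R = 1 / t →
      momentIntegral (symbol ν) t ≤ ENNReal.ofReal (c₀ * R ^ (2 * d + 2)) →
      ∀ (u : EuclideanSpace ℝ (Fin d) → ℝ) (M : ℝ), Measurable u → (∀ x, |u x| ≤ M) →
      ∀ x y, R * ‖y - x‖ ≤ 1 →
        |semigroup P X t u y - semigroup P X t u x| ≤ C * M * (R * ‖y - x‖) := by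
  set K : ℝ := 40 * d
  set W : ℝ := 2 ^ (d + 2) * (volume.real (Metric.closedBall (0 : EuclideanSpace ℝ (Fin d)) 1) +
    Real.exp (2 * K) * c₀)
  obtain ⟨C, hC, H⟩ := exists_abs_integral_add_sub_integral_le (EuclideanSpace ℝ (Fin d)) K W
    (by positivity) (by positivity)
  refine ⟨C, hC, fun P _ X ν hX t R ht hR hφ hmom u M hu hM x y hxy => ?_⟩
  have hν := hX.levyMeasure
  have hK : 0 ≤ K := by positivity
  set ρ := scaledJumps ν t R
  have hρ : ∫⁻ z, ENNReal.ofReal (min 1 (‖z‖ ^ 2)) ∂ρ ≤ ENNReal.ofReal K :=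
    hν.lintegral_scaledJumps_le ht hR hφ
  have hfin := isFiniteMeasure_largeJumps hρ
  obtain ⟨b, hb⟩ := exists_integral_eq_compensatedExponent_add hR hρ
  have hsym : ∀ η, ((t : ℝ) : ℂ) * symbol ν (R • η) = compensatedExponent (smallJumps ρ) η
      + ∫ z, (1 - Complex.exp (Complex.I * ((inner ℝ η z : ℝ) : ℂ))) ∂largeJumps ρ
      + Complex.I * ((inner ℝ η b : ℝ) : ℂ) := fun η =>
    (hν.smul_symbol_eq t hR η).trans (hb η)
  have hlarge : ∀ η : EuclideanSpace ℝ (Fin d),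
      ‖∫ z, (1 - Complex.exp (Complex.I * ((inner ℝ η z : ℝ) : ℂ))) ∂largeJumps ρ‖ ≤ 2 * K := by
    intro η
    refine (norm_integral_le_of_norm_le_const (C := 2) (Eventually.of_forall fun z => ?_)).trans ?_
    · refine (norm_sub_le _ _).trans ?_
      rw [norm_exp_I_mul_ofReal, norm_one]
      norm_num
    · gcongr
      exact ENNReal.toReal_le_of_le_ofReal hK ((largeJumps_univ_le ρ).trans hρ)
  have hre : ∀ η, t * (symbol ν (R • η)).re ≤ (compensatedExponent (smallJumps ρ) η).re + 2 * K := by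
    intro η
    have h1 := congrArg Complex.re (hsym η)
    rw [Complex.re_ofReal_mul] at h1
    simp only [Complex.add_re, Complex.mul_re, Complex.I_re, Complex.I_im, Complex.ofReal_im,
      zero_mul, mul_zero, sub_zero, add_zero] at h1
    have h2 := (Complex.re_le_norm _).trans (hlarge η)
    linarith
  have hsm := integrable_norm_sq_smallJumps hρ
  have hone := norm_le_one_ae_smallJumps ρ
  have hcont : Continuous fun η => t * (symbol ν (R • η)).re := by
    have hc := Complex.continuous_re.comp (continuous_symbol hν)
    exact continuous_const.mul (hc.comp (continuous_const_smul R))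
  obtain ⟨hi, hiW⟩ := integrable_and_integral_le_of_lintegral_le hsm hone hcont hc₀.le hre
    (lintegral_exp_scaled_le hν hR hmom)
  have hXm := hX.measurable t
  set μ : Measure (EuclideanSpace ℝ (Fin d)) := P.map fun ω => R • X t ω
  have hμ : IsProbabilityMeasure μ := Measure.isProbabilityMeasure_map (by fun_prop)
  -- The law of `R • X_t` factors into the small-jump part and the compound Poisson law of the large
  -- jumps translated by `-b`.
  have hch : ∀ η, charFun μ η = Complex.exp (-compensatedExponent (smallJumps ρ) η) *
      charFun (compoundPoisson (largeJumps ρ) ∗ Measure.dirac (-b)) η := by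
    intro η
    rw [charFun_conv, charFun_compoundPoisson, charFun_dirac, ← Complex.exp_add, ← Complex.exp_add,
      charFun_map_smul_comp hXm.aemeasurable, hX.charFun_eq, neg_mul, hsym, inner_neg_left,
      real_inner_comm]
    congr 1
    push_cast
    ring
  -- The test function undoes the scaling and is centred at `x`, so the shift by `R • (y - x)`
  -- replaces `x` by `y`.
  have hshift := H (smallJumps ρ) hsm hone (integral_norm_sq_smallJumps_le hK hρ) hi hiW μ
    (compoundPoisson (largeJumps ρ) ∗ Measure.dirac (-b)) hμ inferInstance hch (R • (y - x))
    (by rwa [norm_smul, Real.norm_of_nonneg hR.le]) (fun z => u (x + R⁻¹ • z)) M (by fun_prop)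
    (fun z => hM _)
  rw [norm_smul, Real.norm_of_nonneg hR.le, integral_map (by fun_prop) (Measurable.aestronglyMeasurable (by fun_prop)),
    integral_map (by fun_prop) (Measurable.aestronglyMeasurable (by fun_prop))] at hshift
  simp only [smul_add, inv_smul_smul₀ hR.ne'] at hshift
  unfold semigroup
  have e : ∀ ω, x + (X t ω + (y - x)) = y + X t ω := fun ω => by abel
  simp only [e] at hshift
  exact hshift

lemma exists_gradSup_semigroup_le (d : ℕ) {c₀ : ℝ} (hc₀ : 0 < c₀) :
    ∃ C : ℝ, 0 < C ∧ ∀ {Ω : Type*} [MeasurableSpace Ω] (P : Measure Ω)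
      [IsProbabilityMeasure P] (X : ℝ≥0 → Ω → EuclideanSpace ℝ (Fin d))
      (ν : Measure (EuclideanSpace ℝ (Fin d))), IsPureJumpLevyProcess P X ν →
      ∀ (t : ℝ≥0) (R : ℝ), 0 < t → 0 < R → supRe (symbol ν) R = 1 / t →
      momentIntegral (symbol ν) t ≤ ENNReal.ofReal (c₀ * R ^ (2 * d + 2)) →
      ∀ u : EuclideanSpace ℝ (Fin d) → ℝ, IsBoundedBorel u →
        gradSup (semigroup P X t u) ≤ ENNReal.ofReal C * supNorm u * ENNReal.ofReal R := by
  obtain ⟨C, hC, H⟩ := exists_semigroup_sub_le d hc₀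
  refine ⟨C, hC, fun P _ X ν hX t R ht hR hφ hmom u hu => ?_⟩
  obtain ⟨hum, B, hB⟩ := hu
  have hfin : supNorm u ≠ ∞ :=
    ((iSup_le fun x => ENNReal.ofReal_le_ofReal (hB x)).trans_lt ENNReal.ofReal_lt_top).ne
  have hM : ∀ x, |u x| ≤ (supNorm u).toReal := fun x =>
    (ENNReal.ofReal_le_iff_le_toReal hfin).1 (le_iSup (fun x => ENNReal.ofReal |u x|) x)
  have hlip := H P X ν hX t R ht hR hφ hmom u _ hum hM
  refine iSup_le fun x => ?_
  rw [← ENNReal.ofReal_toReal hfin, ← ENNReal.ofReal_mul hC.le,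
    ← ENNReal.ofReal_mul (by positivity)]
  refine limsup_le_of_le (by isBoundedDefault) ?_
  -- The Lipschitz bound holds for `‖y - x‖ ≤ 1 / R`, and the limsup sees only such `y`.
  filter_upwards [self_mem_nhdsWithin,
    nhdsWithin_le_nhds (Metric.ball_mem_nhds x (inv_pos.2 hR))] with y hyx hy
  have hpos : 0 < ‖y - x‖ := norm_pos_iff.2 (sub_ne_zero.2 hyx)
  rw [mem_ball_iff_norm] at hy
  refine ENNReal.ofReal_le_ofReal ?_
  rw [div_le_iff₀ hpos]
  refine (hlip x y ?_).trans (le_of_eq (by ring))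
  calc R * ‖y - x‖ ≤ R * R⁻¹ := by gcongr
    _ = 1 := mul_inv_cancel₀ hR.ne'

end Gradient

end LevyGradient

theorem theorem3p3 {d : ℕ} (hd : 1 ≤ d) {Ω : Type*} [MeasurableSpace Ω] (P : Measure Ω)
    [IsProbabilityMeasure P] (X : ℝ≥0 → Ω → EuclideanSpace ℝ (Fin d))
    (ν : Measure (EuclideanSpace ℝ (Fin d)))
    (hX : LevyGradient.IsPureJumpLevyProcess P X ν)
    (hHW : LevyGradient.HartmanWintner (LevyGradient.symbol ν))
    (ψ : ℝ → ℝ)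
    (hψ : LevyGradient.IsInverse (LevyGradient.supRe (LevyGradient.symbol ν)) ψ) :
    -- small times
    ((∃ c₀ : ℝ, 0 < c₀ ∧ ∃ t₀ : ℝ≥0, 0 < t₀ ∧ ∀ t : ℝ≥0, 0 < t → t ≤ t₀ →
        LevyGradient.momentIntegral (LevyGradient.symbol ν) t
          ≤ ENNReal.ofReal (c₀ * ψ (1 / t) ^ (2 * d + 2))) →
      ∃ c : ℝ, 0 < c ∧ ∃ t₁ : ℝ≥0, 0 < t₁ ∧ ∀ t : ℝ≥0, 0 < t → t ≤ t₁ →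
        ∀ u : EuclideanSpace ℝ (Fin d) → ℝ, LevyGradient.IsBoundedBorel u →
          LevyGradient.gradSup (LevyGradient.semigroup P X t u)
            ≤ ENNReal.ofReal c * LevyGradient.supNorm u * ENNReal.ofReal (ψ (1 / t))) ∧
    -- large times
    ((∃ c₀ : ℝ, 0 < c₀ ∧ ∃ t₀ : ℝ≥0, 0 < t₀ ∧ ∀ t : ℝ≥0, t₀ ≤ t →
        LevyGradient.momentIntegral (LevyGradient.symbol ν) t
          ≤ ENNReal.ofReal (c₀ * ψ (1 / t) ^ (2 * d + 2))) →
      ∃ c : ℝ, 0 < c ∧ ∃ t₁ : ℝ≥0, 0 < t₁ ∧ ∀ t : ℝ≥0, t₁ ≤ t →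
        ∀ u : EuclideanSpace ℝ (Fin d) → ℝ, LevyGradient.IsBoundedBorel u →
          LevyGradient.gradSup (LevyGradient.semigroup P X t u)
            ≤ ENNReal.ofReal c * LevyGradient.supNorm u * ENNReal.ofReal (ψ (1 / t))) := by
  refine ⟨?_, ?_⟩
  · rintro ⟨c₀, hc₀, t₀, ht₀, hmom⟩
    obtain ⟨C, hC, H⟩ := LevyGradient.exists_gradSup_semigroup_le d hc₀
    -- The estimate holds at each single `t` satisfying the moment bound, so `t₁ = t₀` works.
    refine ⟨C, hC, t₀, ht₀, fun t ht htt u hu => ?_⟩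
    obtain ⟨hR, hφ⟩ := hψ (1 / t) (by positivity)
    exact H P X ν hX t (ψ (1 / t)) ht hR hφ (hmom t ht htt) u hu
  · rintro ⟨c₀, hc₀, t₀, ht₀, hmom⟩
    obtain ⟨C, hC, H⟩ := LevyGradient.exists_gradSup_semigroup_le d hc₀
    refine ⟨C, hC, t₀, ht₀, fun t htt u hu => ?_⟩
    have ht : 0 < t := ht₀.trans_le htt
    obtain ⟨hR, hφ⟩ := hψ (1 / t) (by positivity)
    exact H P X ν hX t (ψ (1 / t)) ht hR hφ (hmom t htt) u hu
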